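/- **Setting.** A ReLU network with $m$ inputs, $k$ outputs and hidden layers of widths $w_1,\dots,w_L$ is a composition of affine maps, with ReLU applied coordinatewise after each of the first $L$ of them; it has depth $L+1$ and $w_1+\dots+w_L$ hidden units. It is a *random network* if its architecture (the numbers $m,w_1,\dots,w_L,k$) is fixed and its weights and biases are drawn from a discrete probability distribution. A number is a *$B$-bit number* if it equals $\pm a/2^q$ with integers $0\le a<2^B$ and $0\le q\le B$. Let $G=(V,E)$ be a simple graph and let $\mathcal N(v)$ denote the neighborhood of $v$ including $v$ itself. Given a distribution $D$ on networks with $d$ inputs and $d$ outputs and a vector $h^{(0)}\in\{0,1\}^d\setminus\{0\}$, put $h^{(0)}_v=h^{(0)}$ for all $v\in V$, and for $k\ge 1$ $$h^{(k)}_v=\phi^{(k)}\Big(\sum_{w\in\mathcal N(v)}h^{(k-1)}_w\Big)\qquad(v\in V),$$ where $\phi^{(1)},\phi^{(2)},\dots$ are independent samples from $D$. Let $\mathcal H^{(k-1)}_v$ be the multiset $\{h^{(k-1)}_w:w\in\mathcal N(v)\}$. Iteration $k$ is *successful with failure probability $p$* if for all $v,u\in V$: * with probability $1$: if $\mathcal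 H^{(k-1)}_v=\mathcal H^{(k-1)}_u$ then $h^{(k)}_v=h^{(k)}_u$; * with probability at least $1-p$: if $\mathcal H^{(k-1)}_v\ne\mathcal H^{(k-1)}_u$ then $h^{(k)}_v\ne h^{(k)}_u$. The probability is over $\phi^{(1)},\dots,\phi^{(k)}$. We say that $D$ *performs WL iterations on $n$-node graphs with failure probability $p$ and $B$ bits of precision* if $d\ge 1$, all weights and biases of the networks in the support of $D$ are $B$-bit numbers, and for every graph $G$ with $n$ nodes, every $h^{(0)}\in\{0,1\}^d\setminus\{0\}$ and every $k\ge 1$: iteration $k$ is successful with failure probability $p$; with probability $1$ all labels $h_v^{(k)}$ are in $\{0,1\}^d$; and with probability $1$ all values computed by the units of $\phi^{(k)}$ in that iteration are $B$-bit numbers. **Theorem.** There is an integer $e\ge 0$ such that for every integer $c\ge 0$ there is a constant $C$ such that for every $n\ge 2$: 1. There is a random ReLU network that performs WL iterations on $n$-node graphs with failure probability $n^{-c}$ and at most $C\log n$ bits of precision, whose labels have dimension $d\le C\log n$, and which has depth at most $C\log n$ and at most $C(\log n)^e$ hidden units. 2. More generally, for every integer $t>0$ there is a random ReLU network that performs WL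 iterations on $n$-node graphs with failure probability $n^{-c}$ and at most $C\log n$ bits of precision, whose labels have dimension $d\le C\log n$, and which has depth at most $C\,t$ and at most $C\,n^{C/t}(\log n)^e$ hidden units. -/

import Mathlib

open scoped ENNReal

/-! ### Feedforward ReLU networks -/

/-- The rectified linear unit. -/
noncomputable def relu (x : ℝ) : ℝ := max x 0

/-- The parameters of an affine map from `ℝ^m` to `ℝ^k`. -/
structure AffineLayer (m k : ℕ) where
  weight : Matrix (Fin k) (Fin m) ℝ
  bias : Fin k → ℝ

namespace AffineLayer

/-- The affine map `x ↦ W x + b`. -/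
noncomputable def eval {m k : ℕ} (L : AffineLayer m k) (x : Fin m → ℝ) : Fin k → ℝ :=
  L.weight.mulVec x + L.bias

end AffineLayer

/-- `ReLUNet m ws k` is the type of weight assignments of the layered ReLU network architecture
with `m` inputs, `k` (affine) outputs and hidden layers of the widths listed in `ws`.
It has `ws.sum` hidden units and depth (number of affine layers) `ws.length + 1`. -/
inductive ReLUNet : ℕ → List ℕ → ℕ → Type
  | output {m k : ℕ} (L : AffineLayer m k) : ReLUNet m [] k
  | hidden {m w : ℕ} {ws : List ℕ} {k : ℕ} (L : AffineLayer m w) (N : ReLUNet w ws k) :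
      ReLUNet m (w :: ws) k

/-- `x` is a signed binary number with at most `B` binary digits, the binary point being at most
`B` places from the right: `x = m / 2 ^ q` with `|m| < 2 ^ B` and `q ≤ B`. -/
def HasBits (B : ℕ) (x : ℝ) : Prop :=
  ∃ (m : ℤ) (q : ℕ), |m| < 2 ^ B ∧ q ≤ B ∧ x = (m : ℝ) / 2 ^ q

namespace ReLUNet

/-- The function computed by a network: every hidden layer applies its affine map and then the
ReLU in every coordinate; the last layer is affine. -/
noncomputable def eval {m : ℕ} {ws : List ℕ} {k : ℕ} :
    ReLUNet m ws k → (Fin m → ℝ) → (Fin k → ℝ)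
  | output L, x => L.eval x
  | hidden L N, x => N.eval (fun i => relu (L.eval x i))

/-- All weights and biases of the network are `B`-bit numbers. -/
def WeightsHaveBits (B : ℕ) {m : ℕ} {ws : List ℕ} {k : ℕ} : ReLUNet m ws k → Prop
  | output L => (∀ i j, HasBits B (L.weight i j)) ∧ ∀ i, HasBits B (L.bias i)
  | hidden L N =>
      ((∀ i j, HasBits B (L.weight i j)) ∧ ∀ i, HasBits B (L.bias i)) ∧ N.WeightsHaveBits B

/-- When the network is evaluated at the given input, the value computed by each of its units
(before the ReLU is applied; hence also after it) and each of its outputs is a `B`-bit number. -/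
def ValuesHaveBits (B : ℕ) {m : ℕ} {ws : List ℕ} {k : ℕ} :
    ReLUNet m ws k → (Fin m → ℝ) → Prop
  | output L, x => ∀ i, HasBits B (L.eval x i)
  | hidden L N, x =>
      (∀ i, HasBits B (L.eval x i)) ∧ N.ValuesHaveBits B (fun i => relu (L.eval x i))

end ReLUNet

/-! ### Iterations of a graph neural network with sum aggregation -/

section GNN

variable {V : Type} [Fintype V] {d : ℕ} {ws : List ℕ}

open scoped Classical in
/-- The neighborhood of `v`, including `v` itself. -/
noncomputable def closedNbhd (G : SimpleGraph V) (v : V) : Finset V :=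
  Finset.univ.filter fun w => w = v ∨ G.Adj v w

/-- The multiset of the labels of the nodes in the closed neighborhood of `v`. -/
noncomputable def nbhdLabels (G : SimpleGraph V) (h : V → Fin d → ℝ) (v : V) :
    Multiset (Fin d → ℝ) :=
  (closedNbhd G v).val.map h

/-- One iteration with combine function `φ` and sum aggregation: the new label of `v` is
`φ (∑_{w ∈ N(v)} h_w)`. -/
noncomputable def gnnStep (G : SimpleGraph V) (φ : ReLUNet d ws d) (h : V → Fin d → ℝ) :
    V → Fin d → ℝ :=
  fun v => φ.eval (nbhdLabels G h v).sum

/-- The joint law of the pair (existing labels, new labels) of one iteration, when the existing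
labels have law `E` and the network is drawn from `D` independently of them. -/
noncomputable def iterationLaw (G : SimpleGraph V) (E : PMF (V → Fin d → ℝ))
    (D : PMF (ReLUNet d ws d)) : PMF ((V → Fin d → ℝ) × (V → Fin d → ℝ)) :=
  E.bind fun h => D.map fun φ => (h, gnnStep G φ h)

/-- The law of the labels after `k` iterations that start with the label `h₀` at every node, where
the network of each iteration is a fresh independent sample from `D`. -/
noncomputable def labelLaw (G : SimpleGraph V) (h₀ : Fin d → ℝ) (D : PMF (ReLUNet d ws d)) :
    ℕ → PMF (V → Fin d → ℝ)
  | 0 => PMF.pure fun _ => h₀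
  | k + 1 => (iterationLaw G (labelLaw G h₀ D k) D).map Prod.snd

/-- One iteration with existing labels of law `E` and network of law `D` is a successful
iteration of the WL test with failure probability `p`: for any two nodes, if their multisets of
neighborhood labels agree, then their new labels agree, with probability one; and, with
probability at least `1 - p`, if the multisets differ then so do the new labels. -/
def IsSuccessfulIteration (G : SimpleGraph V) (E : PMF (V → Fin d → ℝ))
    (D : PMF (ReLUNet d ws d)) (p : ℝ≥0∞) : Prop :=
  ∀ v u : V,
    (iterationLaw G E D).toOuterMeasure
        {s | nbhdLabels G s.1 v = nbhdLabels G s.1 u → s.2 v = s.2 u} = 1 ∧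
    1 - p ≤ (iterationLaw G E D).toOuterMeasure
        {s | nbhdLabels G s.1 v ≠ nbhdLabels G s.1 u → s.2 v ≠ s.2 u}

end GNN

/-- The vector has all its entries in `{0, 1}`. -/
def IsBinary {d : ℕ} (x : Fin d → ℝ) : Prop := ∀ i, x i = 0 ∨ x i = 1

/-- The random network of law `D`, with label dimension `d` and hidden widths `ws`, performs
WL iterations on all graphs with `n` nodes, with failure probability `p` and `B` bits of precision.
The common initial label is an arbitrary nonzero binary vector. -/
structure PerformsWL (n d B : ℕ) (p : ℝ≥0∞) {ws : List ℕ} (D : PMF (ReLUNet d ws d)) : Prop where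
  /-- Labels have positive dimension, so that a nonzero initial label exists. -/
  dim_pos : 0 < d
  weights : ∀ φ ∈ D.support, φ.WeightsHaveBits B
  successful : ∀ (G : SimpleGraph (Fin n)) (h₀ : Fin d → ℝ), IsBinary h₀ → h₀ ≠ 0 →
    ∀ k : ℕ, IsSuccessfulIteration G (labelLaw G h₀ D k) D p
  binary : ∀ (G : SimpleGraph (Fin n)) (h₀ : Fin d → ℝ), IsBinary h₀ → h₀ ≠ 0 →
    ∀ k : ℕ, ∀ h ∈ (labelLaw G h₀ D k).support, ∀ v, IsBinary (h v)
  values : ∀ (G : SimpleGraph (Fin n)) (h₀ : Fin d → ℝ), IsBinary h₀ → h₀ ≠ 0 →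
    ∀ k : ℕ, ∀ h ∈ (labelLaw G h₀ D k).support, ∀ φ ∈ D.support, ∀ v,
      φ.ValuesHaveBits B (nbhdLabels G h v).sum

/-! The new label of a node is a random hash in `𝔽₂^d`, read as a 0/1 vector, of its neighborhood
sum `s`, an integer vector with entries at most `n`. An iteration can fail in two ways: two
different sums get the same hash, or two different multisets of labels already had the same sum. One
property of the hash `F` excludes both with high probability: for every fixed nonempty set `S` of at
most `n` vectors, `∑_{s ∈ S} F(s)` is rarely zero modulo 2 (`IsHashFamily.sum_fraction`). Pairs `S`
handle the first failure. For the second, labels of different multisets with equal sums give an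
integer relation `∑ a(s) F(s) = 0` among the previous hashes, where `a`, the difference of
multiplicities, is nonzero and fixed before `F` is drawn. Dividing by the gcd and reducing modulo 2
leaves a nonempty `S` with `∑_{s ∈ S} F(s) = 0` (`exists_subset_of_multiset_ne`). Only the last two
networks matter, so errors do not accumulate over the iterations. The hash first maps `s` to a
number `z = ∑ a_i s_i` with random `a_i < M`, then reads the `T` base-`b` digits of `z`. Each digit
`j` replaces the state `x ∈ 𝔽₂^d` by `A (e_j ⊗ x)`, with a fresh random matrix `A` for each
position. Numbers that share all later digits merge into one vector before `A` acts; tags keep the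
merged vector nonzero, and a random matrix kills it with probability at most `2^{-d}`
(`digitHash_sum_fraction`, `vecHash_sum_fraction`). Digits, conjunctions and parities are short sums
of ReLU ramps, so four hidden layers process a digit (`digitNet_computes`). Taking `b = 2^g` with `g
t` of order `log n` and `T` proportional to `t` gives depth `O(t)` and width `n^{O(1/t)}` up to
logarithms; `g = 1` gives the first part. -/

/-! ### Layers with integer parameters -/

/-- The affine layer with the given integer parameters, its inputs and outputs being indexed by
arbitrary types. -/
noncomputable def intLayer {m k : ℕ} {ι κ : Type} (e : Fin m ≃ ι) (f : Fin k ≃ κ)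
    (W : κ → ι → ℤ) (b : κ → ℤ) : AffineLayer m k where
  weight := fun j i => (W (f j) (e i) : ℝ)
  bias := fun j => (b (f j) : ℝ)

/-- The standard enumeration of a finite type. -/
noncomputable def enum (ι : Type) [Fintype ι] : Fin (Fintype.card ι) ≃ ι :=
  (Fintype.equivFin ι).symm

theorem intLayer_eval {m k : ℕ} {ι κ : Type} [Fintype ι] (e : Fin m ≃ ι) (f : Fin k ≃ κ)
    (W : κ → ι → ℤ) (b : κ → ℤ) (ξ : ι → ℤ) (j : Fin k) :
    (intLayer e f W b).eval (fun i => (ξ (e i) : ℝ)) j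
      = ((∑ i, W (f j) i * ξ i + b (f j) : ℤ) : ℝ) := by
  simp only [AffineLayer.eval, intLayer, Pi.add_apply, Matrix.mulVec, dotProduct]
  push_cast
  rw [Equiv.sum_comp e (fun i => (W (f j) i : ℝ) * (ξ i : ℝ))]

theorem relu_intCast (z : ℤ) : relu (z : ℝ) = ((max z 0 : ℤ) : ℝ) := by
  simp [relu]

theorem hasBits_intCast {B : ℕ} {z : ℤ} (hz : |z| < 2 ^ B) : HasBits B (z : ℝ) :=
  ⟨z, 0, hz, Nat.zero_le _, by simp⟩

/-- On the input `x` the network outputs `y`, and all its units have `B`-bit values. -/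
def Computes (B : ℕ) {m : ℕ} {ws : List ℕ} {k : ℕ} (N : ReLUNet m ws k)
    (x : Fin m → ℝ) (y : Fin k → ℝ) : Prop :=
  N.ValuesHaveBits B x ∧ N.eval x = y

theorem computes_output {B m k : ℕ} {ι κ : Type} [Fintype ι] (e : Fin m ≃ ι) (f : Fin k ≃ κ)
    {W : κ → ι → ℤ} {b : κ → ℤ} {ξ : ι → ℤ} (η : κ → ℤ)
    (hη : ∀ j, ∑ i, W j i * ξ i + b j = η j) (hB : ∀ j, |η j| < 2 ^ B) :
    Computes B (.output (intLayer e f W b)) (fun i => (ξ (e i) : ℝ)) (fun j => (η (f j) : ℝ)) := by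
  constructor
  · intro j
    rw [intLayer_eval, hη]
    exact hasBits_intCast (hB _)
  · funext j
    rw [ReLUNet.eval, intLayer_eval, hη]

/-- Integer parameters keep integer inputs integer, so precision reduces to a size bound on the
values `η` before the ReLU, and networks can be verified layer by layer. -/
theorem computes_hidden {B m w k : ℕ} {ws : List ℕ} {ι κ : Type} [Fintype ι]
    (e : Fin m ≃ ι) (f : Fin w ≃ κ) {W : κ → ι → ℤ} {b : κ → ℤ} {N : ReLUNet w ws k}
    {ξ : ι → ℤ} (η : κ → ℤ) {y : Fin k → ℝ}
    (hη : ∀ j, ∑ i, W j i * ξ i + b j = η j) (hB : ∀ j, |η j| < 2 ^ B)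
    (hN : Computes B N (fun j => ((max (η (f j)) 0 : ℤ) : ℝ)) y) :
    Computes B (.hidden (intLayer e f W b) N) (fun i => (ξ (e i) : ℝ)) y := by
  have h : (fun j => relu ((intLayer e f W b).eval (fun i => (ξ (e i) : ℝ)) j))
      = fun j => ((max (η (f j)) 0 : ℤ) : ℝ) := by
    funext j
    rw [intLayer_eval, hη, relu_intCast]
  refine ⟨⟨fun j => ?_, ?_⟩, ?_⟩
  · rw [intLayer_eval, hη]
    exact hasBits_intCast (hB _)
  · rw [h]; exact hN.1
  · rw [ReLUNet.eval, h]; exact hN.2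

theorem intLayer_hasBits {B m k : ℕ} {ι κ : Type} (e : Fin m ≃ ι) (f : Fin k ≃ κ)
    {W : κ → ι → ℤ} {b : κ → ℤ} (hW : ∀ j i, |W j i| < 2 ^ B) (hb : ∀ j, |b j| < 2 ^ B) :
    (∀ j i, HasBits B ((intLayer e f W b).weight j i)) ∧
      ∀ j, HasBits B ((intLayer e f W b).bias j) :=
  ⟨fun _ _ => hasBits_intCast (hW _ _), fun _ => hasBits_intCast (hb _)⟩

/-! ### The hash function -/

open Matrix

/-- The matrices that mix the state with one digit. -/
abbrev MixMatrix (b d : ℕ) := Matrix (Fin d) (Fin b × Fin d) (ZMod 2)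

/-- The tensor product of the basis vector `e_j` with a vector. -/
def tag (b : ℕ) {d : ℕ} (j : ℕ) : (Fin d → ZMod 2) →ₗ[ZMod 2] (Fin b × Fin d → ZMod 2) where
  toFun x := fun p => if (p.1 : ℕ) = j then x p.2 else 0
  map_add' x y := by ext p; by_cases h : (p.1 : ℕ) = j <;> simp [h]
  map_smul' a x := by ext p; by_cases h : (p.1 : ℕ) = j <;> simp [h]

/-- The product of the matrices selected by the `T` base-`b` digits of `z`, the leading digit acting
first. -/
def digitHash {b d : ℕ} : (T : ℕ) → (Fin T → MixMatrix b d) → ℕ →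
    ((Fin d → ZMod 2) →ₗ[ZMod 2] (Fin d → ZMod 2))
  | 0, _, _ => LinearMap.id
  | T + 1, A, z =>
      digitHash T (Fin.tail A) (z % b ^ T) ∘ₗ (A 0).mulVecLin ∘ₗ tag b (z / b ^ T)

/-- The parameters of the hash function of vectors: the coefficients of a linear form and the
mixing matrices. -/
abbrev HashSeed (b d M T : ℕ) := (Fin d → Fin M) × (Fin T → MixMatrix b d)

/-- The value of the linear form. -/
def seedDot {d M : ℕ} (a : Fin d → Fin M) (s : Fin d → ℕ) : ℕ := ∑ i, (a i : ℕ) * s i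

/-- The hash of a vector of natural numbers. -/
def vecHash {b d M T : ℕ} (ω : HashSeed b d M T) (s : Fin d → ℕ) : Fin d → ZMod 2 :=
  digitHash T ω.2 (seedDot ω.1 s) 1

/-! ### The network that computes it -/

/-- Signs with which four ramps add up to the indicator function of an interval. -/
def bumpSign : Fin 4 → ℤ := ![1, -1, -1, 1]

/-- The offsets of four ramps that add up to the indicator function of `[jP, (j+1)P)`. -/
def bumpBias (P j : ℕ) : Fin 4 → ℤ :=
  ![1 - j * P, -(j * P), 1 - (j + 1) * P, -((j + 1) * P)]

/-- The coefficients of the ramps in the sawtooth function that computes parities. -/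
def sawCoeff (m : ℕ) : ℤ := if m = 0 then 1 else 2 * (-1) ^ m

section Layers

variable (b d P : ℕ)

/-- Ramps of the number in the state, the state being copied. -/
def rampWeight : Option (Fin d) ⊕ (Fin b × Fin 4) → Option (Fin d) → ℤ
  | .inl o, o' => if o' = o then 1 else 0
  | .inr _, o' => if o' = none then 1 else 0

/-- Offsets of the ramps. -/
def rampBias : Option (Fin d) ⊕ (Fin b × Fin 4) → ℤ
  | .inl _ => 0
  | .inr p => bumpBias P p.1 p.2

/-- The number without its leading digit, and the bits of the state tagged with that digit. -/
def tagWeight : Option (Fin b × Fin d) → Option (Fin d) ⊕ (Fin b × Fin 4) → ℤ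
  | none, .inl none => 1
  | none, .inl (some _) => 0
  | none, .inr q => -(q.1 * P) * bumpSign q.2
  | some _, .inl none => 0
  | some p, .inl (some l) => if l = p.2 then 1 else 0
  | some p, .inr q => if q.1 = p.1 then bumpSign q.2 else 0

/-- Offsets that turn the sum of two bits into their conjunction. -/
def tagBias : Option (Fin b × Fin d) → ℤ
  | none => 0
  | some _ => -1

variable {b d}

/-- Ramps of the integer matrix products. -/
def mixWeight (A : MixMatrix b d) : Option (Fin d × Fin (d + 1)) → Option (Fin b × Fin d) → ℤ
  | none, none => 1
  | none, some _ => 0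
  | some _, none => 0
  | some q, some p => (A q.1 p).val

variable (d)

/-- Offsets of the ramps of the integer matrix products. -/
def mixBias : Option (Fin d × Fin (d + 1)) → ℤ
  | none => 0
  | some q => -(q.2 : ℕ)

/-- The parities of the integer matrix products. -/
def parityWeight : Option (Fin d) → Option (Fin d × Fin (d + 1)) → ℤ
  | none, none => 1
  | none, some _ => 0
  | some _, none => 0
  | some k, some q => if q.1 = k then sawCoeff q.2 else 0

/-- The bits of the state. -/
def readWeight : Fin d → Option (Fin d) → ℤ
  | _, none => 0
  | k, some l => if l = k then 1 else 0

variable {d}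

/-- The linear form that gives the initial number. -/
def startWeight {M : ℕ} (a : Fin d → Fin M) : Option (Fin d) → Fin d → ℤ
  | none, i => (a i : ℕ)
  | some _, _ => 0

variable (d)

/-- The initial bits of the state, all equal to one. -/
def startBias : Option (Fin d) → ℤ
  | none => 0
  | some _ => 1

end Layers

/-- The widths of the part of the network that processes `T` digits. -/
def digitWidths (b d : ℕ) : ℕ → List ℕ
  | 0 => []
  | T + 1 => Fintype.card (Option (Fin d) ⊕ (Fin b × Fin 4)) ::
      Fintype.card (Option (Fin b × Fin d)) ::
      Fintype.card (Option (Fin d × Fin (d + 1))) ::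
      Fintype.card (Option (Fin d)) :: digitWidths b d T

/-- The network that computes `digitHash`. -/
noncomputable def digitNet {b d : ℕ} : (T : ℕ) → (Fin T → MixMatrix b d) →
    ReLUNet (Fintype.card (Option (Fin d))) (digitWidths b d T) d
  | 0, _ => .output (intLayer (enum _) (Equiv.refl _) (readWeight d) 0)
  | T + 1, A =>
      .hidden (intLayer (enum _) (enum _) (rampWeight b d) (rampBias b d (b ^ T))) <|
      .hidden (intLayer (enum _) (enum _) (tagWeight b d (b ^ T)) (tagBias b d)) <|
      .hidden (intLayer (enum _) (enum _) (mixWeight (A 0)) (mixBias d)) <|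
      .hidden (intLayer (enum _) (enum _) (parityWeight d) 0) <|
      digitNet T (Fin.tail A)

/-- The widths of the hidden layers of `hashNet`. -/
def hashWidths (b d T : ℕ) : List ℕ := Fintype.card (Option (Fin d)) :: digitWidths b d T

/-- The network that computes `vecHash`. -/
noncomputable def hashNet {b d M T : ℕ} (ω : HashSeed b d M T) : ReLUNet d (hashWidths b d T) d :=
  .hidden (intLayer (Equiv.refl _) (enum _) (startWeight ω.1) (startBias d)) (digitNet T ω.2)

theorem digitWidths_length (b d T : ℕ) : (digitWidths b d T).length = 4 * T := by
  induction T with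
  | zero => rfl
  | succ T ih => simp only [digitWidths, List.length_cons, ih]; ring

theorem digitWidths_sum (b d T : ℕ) :
    (digitWidths b d T).sum = T * (4 * b + b * d + d * (d + 1) + 2 * d + 4) := by
  induction T with
  | zero => simp [digitWidths]
  | succ T ih =>
    simp only [digitWidths, List.sum_cons, ih, Fintype.card_sum, Fintype.card_option,
      Fintype.card_prod, Fintype.card_fin]
    ring

/-! ### Correctness of the network -/

/-- The state of the network: a number and a binary vector. -/
def hashState {d : ℕ} (z : ℕ) (x : Fin d → ZMod 2) : Option (Fin d) → ℤ
  | none => z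
  | some l => (x l).val

/-- The slope of the ramp sum between `u` and `u + 1` is the partial sum of the coefficients `1, -2,
2, -2, …`, which is `(-1)^u`; so the sum alternates between 0 and 1. -/
theorem saw_sum (N u : ℕ) (hu : u ≤ N) :
    ∑ m ∈ Finset.range N, sawCoeff m * max ((u : ℤ) - m) 0 = ((u % 2 : ℕ) : ℤ) := by
  have hc : ∀ u : ℕ, ∑ m ∈ Finset.range (u + 1), sawCoeff m = (-1) ^ u := by
    intro u
    induction u with
    | zero => simp [sawCoeff]
    | succ u ih => rw [Finset.sum_range_succ, ih, sawCoeff]; simp; ring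
  have key : ∀ u : ℕ, u ≤ N → ∑ m ∈ Finset.range N, sawCoeff m * max ((u : ℤ) - m) 0 =
      ∑ m ∈ Finset.range u, sawCoeff m * ((u : ℤ) - m) := by
    intro u hu
    rw [← Finset.sum_subset (Finset.range_subset_range.2 hu)]
    · refine Finset.sum_congr rfl fun m hm => ?_
      rw [max_eq_left]
      have := Finset.mem_range.1 hm
      omega
    · intro m _ hm
      rw [max_eq_right, mul_zero]
      have := mt Finset.mem_range.2 hm
      omega
  rw [key u hu]
  clear key hu
  induction u with
  | zero => simp
  | succ u ih =>
    have : ∑ m ∈ Finset.range (u + 1), sawCoeff m * (((u + 1 : ℕ) : ℤ) - m)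
        = ∑ m ∈ Finset.range (u + 1), sawCoeff m * ((u : ℤ) - m)
          + ∑ m ∈ Finset.range (u + 1), sawCoeff m := by
      rw [← Finset.sum_add_distrib]
      refine Finset.sum_congr rfl fun m _ => ?_
      push_cast; ring
    rw [this, hc, Finset.sum_range_succ, sub_self, mul_zero, add_zero, ih]
    rcases Nat.even_or_odd u with h | h
    · rw [h.neg_one_pow, Nat.even_iff.1 h, Nat.odd_iff.1 h.add_one]; rfl
    · rw [h.neg_one_pow, Nat.odd_iff.1 h, Nat.even_iff.1 h.add_one]; rfl

/-- On integers, two ramps with offsets differing by 1 subtract to a unit step; the difference of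
the steps at `jP` and `(j+1)P` is the indicator. -/
theorem bump_sum (P j z : ℕ) (hP : 0 < P) :
    ∑ q, bumpSign q * max ((z : ℤ) + bumpBias P j q) 0 = if j = z / P then 1 else 0 := by
  have h1 : (j = z / P) ↔ ((j : ℤ) * P ≤ z ∧ (z : ℤ) < (j + 1) * P) := by
    rw [eq_comm, Nat.div_eq_iff hP]
    constructor
    · rintro ⟨h, h'⟩
      refine ⟨by exact_mod_cast h, ?_⟩
      have : z < (j + 1) * P := by rw [Nat.add_mul]; omega
      exact_mod_cast this
    · rintro ⟨h, h'⟩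
      refine ⟨by exact_mod_cast h, ?_⟩
      have : z < (j + 1) * P := by exact_mod_cast h'
      rw [Nat.add_mul] at this; omega
  have h2 : ((j : ℤ) + 1) * P = j * P + P := by ring
  simp only [h1, Fin.sum_univ_four, bumpSign, bumpBias, h2]
  simp
  generalize (j : ℤ) * P = w
  have : (0 : ℤ) < P := by exact_mod_cast hP
  split_ifs <;> omega

theorem val_zmod_two_le (a : ZMod 2) : a.val ≤ 1 := Nat.lt_succ_iff.1 (ZMod.val_lt a)

theorem hashState_nonneg {d : ℕ} (z : ℕ) (x : Fin d → ZMod 2) (o : Option (Fin d)) :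
    0 ≤ hashState z x o := by
  cases o <;> exact Int.natCast_nonneg _

theorem ramp_sum {b d P z : ℕ} (x : Fin d → ZMod 2) (j : Option (Fin d) ⊕ (Fin b × Fin 4)) :
    ∑ i, rampWeight b d j i * hashState z x i + rampBias b d P j =
      Sum.elim (hashState z x) (fun p => (z : ℤ) + bumpBias P p.1 p.2) j := by
  rcases j with o | p
  · simp [rampWeight, rampBias]
  · simp [rampWeight, rampBias, hashState]

/-- Since `z / P < b`, exactly one of the `b` bumps fires. It is the leading digit, whose
contribution to `z` can then be subtracted linearly. -/
theorem tag_sum {b d P z : ℕ} (hP : 0 < P) (hz : z < b * P) (x : Fin d → ZMod 2)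
    (j : Option (Fin b × Fin d)) :
    ∑ i, tagWeight b d P j i *
        max (Sum.elim (hashState z x) (fun p => (z : ℤ) + bumpBias P p.1 p.2) i) 0
        + tagBias b d j =
      j.elim ((z % P : ℕ) : ℤ)
        (fun p => (x p.2).val + (if (p.1 : ℕ) = z / P then 1 else 0) - 1) := by
  have hzP : z / P < b := Nat.div_lt_of_lt_mul (by rwa [mul_comm])
  simp only [Fintype.sum_sum_type, Sum.elim_inl, Sum.elim_inr,
    max_eq_left (hashState_nonneg z x _), Fintype.sum_option, Fintype.sum_prod_type]
  rcases j with _ | p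
  · simp only [tagWeight, tagBias, hashState, zero_mul, one_mul, Finset.sum_const_zero,
      mul_assoc, ← Finset.mul_sum, bump_sum _ _ _ hP, Option.elim_none]
    rw [Finset.sum_eq_single ⟨z / P, hzP⟩]
    · have := Nat.mod_add_div' z P
      have h : ((z % P : ℕ) : ℤ) + ((z / P : ℕ) : ℤ) * P = z := by exact_mod_cast this
      simp only [if_true, mul_one]
      linarith
    · intro j _ hj
      rw [if_neg (fun h => hj (Fin.ext h)), mul_zero]
    · simp
  · simp only [tagWeight, tagBias, hashState, zero_mul, Option.elim_some, ite_mul, one_mul,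
      Finset.sum_ite_eq', Finset.mem_univ, if_true]
    rw [Finset.sum_eq_single p.1]
    · simp only [if_true, bump_sum _ _ _ hP]; ring
    · intro j _ hj
      simp [hj]
    · simp

theorem tag_relu {b d D : ℕ} (x : Fin d → ZMod 2) (p : Fin b × Fin d) :
    max (((x p.2).val : ℤ) + (if (p.1 : ℕ) = D then 1 else 0) - 1) 0 = (tag b D x p).val := by
  have := val_zmod_two_le (x p.2)
  by_cases h : (p.1 : ℕ) = D
  · simp [tag, h, -ZMod.natCast_val]
  · simp [tag, h, -ZMod.natCast_val]; omega

/-- The inner product of a row of the mixing matrix with a binary vector, computed in `ℕ`. -/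
def rowDot {b d : ℕ} (A : MixMatrix b d) (y : Fin b × Fin d → ZMod 2) (k : Fin d) : ℕ :=
  ∑ p, (A k p).val * (y p).val

theorem mulVec_val {b d : ℕ} (A : MixMatrix b d) (y : Fin b × Fin d → ZMod 2) (k : Fin d) :
    ((A *ᵥ y) k).val = rowDot A y k % 2 := by
  rw [← ZMod.val_natCast]
  congr 1
  simp [rowDot, mulVec, dotProduct]

/-- A tagged vector is supported in a single block of `d` coordinates. Hence `d + 1` ramps per row,
independently of `b`, are enough to compute the parity. -/
theorem rowDot_tag_le {b d : ℕ} (A : MixMatrix b d) (D : ℕ) (x : Fin d → ZMod 2) (k : Fin d) :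
    rowDot A (tag b D x) k ≤ d := by
  calc rowDot A (tag b D x) k ≤ ∑ p : Fin b × Fin d, if (p.1 : ℕ) = D then 1 else 0 := by
        refine Finset.sum_le_sum fun p _ => ?_
        by_cases h : (p.1 : ℕ) = D
        · simpa [tag, h] using Nat.mul_le_mul (val_zmod_two_le _) (val_zmod_two_le _)
        · simp [tag, h]
    _ = ∑ j : Fin b, if (j : ℕ) = D then d else 0 := by
        rw [Fintype.sum_prod_type]
        refine Finset.sum_congr rfl fun j _ => ?_
        split_ifs <;> simp
    _ ≤ d := by
        by_cases h : D < b
        · rw [Finset.sum_eq_single ⟨D, h⟩]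
          · simp
          · intro j _ hj
            exact if_neg fun h => hj (Fin.ext h)
          · simp
        · rw [Finset.sum_eq_zero]
          · exact Nat.zero_le _
          · intro j _
            exact if_neg fun h' => h (by rw [← h']; exact j.2)

theorem mix_sum {b d D r : ℕ} (A : MixMatrix b d) (x : Fin d → ZMod 2)
    (j : Option (Fin d × Fin (d + 1))) :
    ∑ i, mixWeight A j i *
        max (i.elim (r : ℤ)
          (fun p => ((x p.2).val : ℤ) + (if (p.1 : ℕ) = D then 1 else 0) - 1)) 0
        + mixBias d j =
      j.elim (r : ℤ) (fun q => (rowDot A (tag b D x) q.1 : ℤ) - (q.2 : ℕ)) := by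
  rw [Fintype.sum_option]
  simp only [Option.elim_some, tag_relu, Option.elim_none]
  rcases j with _ | q
  · simp [mixWeight, mixBias]
  · simp [mixWeight, mixBias, rowDot, sub_eq_add_neg]

theorem parity_sum {b d D r : ℕ} (A : MixMatrix b d) (x : Fin d → ZMod 2)
    (j : Option (Fin d)) :
    ∑ i, parityWeight d j i *
        max (i.elim (r : ℤ) (fun q => (rowDot A (tag b D x) q.1 : ℤ) - (q.2 : ℕ))) 0
        + (0 : Option (Fin d) → ℤ) j = hashState r (A *ᵥ tag b D x) j := by
  rw [Fintype.sum_option, Pi.zero_apply, add_zero]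
  rcases j with _ | k
  · simp [parityWeight, hashState]
  · simp only [parityWeight, zero_mul, zero_add, hashState, Option.elim_some,
      Fintype.sum_prod_type, ite_mul]
    rw [Finset.sum_eq_single k]
    · simp only [if_true]
      rw [mulVec_val, ← saw_sum (d + 1) _ ((rowDot_tag_le A D x k).trans (Nat.le_succ d)),
        Finset.sum_range]
    · intro j _ hj
      simp [hj]
    · simp

theorem abs_bumpSign_le (q : Fin 4) : |bumpSign q| ≤ 1 := by
  fin_cases q <;> simp [bumpSign]

theorem bumpBias_mem {b P : ℕ} (j : Fin b) (q : Fin 4) :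
    -((b * P : ℕ) : ℤ) ≤ bumpBias P j q ∧ bumpBias P j q ≤ 1 := by
  have h : (((j : ℕ) : ℤ) + 1) * P ≤ (b * P : ℕ) := by
    exact_mod_cast Nat.mul_le_mul_right P (Nat.succ_le_of_lt j.2)
  have h0 : (0 : ℤ) ≤ ((j : ℕ) : ℤ) * P := by positivity
  have h1 : (0 : ℤ) ≤ P := by positivity
  have h2 : (((j : ℕ) : ℤ) + 1) * P = ((j : ℕ) : ℤ) * P + P := by ring
  rw [h2, Nat.cast_mul] at h
  simp only [bumpBias, h2]
  fin_cases q <;> simp <;> constructor <;> linarith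

/-- One digit costs four layers: ramps, tagging, integer matrix product, parity. The values in the
ramp layer are controlled by `b ^ T + 1`, those of the row products by `d`, and the invariant `z < b
^ T` passes to the remainder. -/
theorem digitNet_computes {B b d : ℕ} (hb : 0 < b) (hd : d + 2 < 2 ^ B) :
    ∀ (T : ℕ) (A : Fin T → MixMatrix b d) (z : ℕ) (x : Fin d → ZMod 2), z < b ^ T →
      b ^ T + 1 < 2 ^ B →
      Computes B (digitNet T A) (fun i => (hashState z x (enum _ i) : ℝ))
        (fun k => (((digitHash T A z x k).val : ℤ) : ℝ)) := by
  intro T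
  induction T with
  | zero =>
    intro A z x _ _
    refine computes_output _ (Equiv.refl _) (fun k => ((x k).val : ℤ)) (fun k => ?_) (fun k => ?_)
    · rw [Fintype.sum_option]
      simp [readWeight, hashState]
    · have := val_zmod_two_le (x k)
      zify at this hd
      rw [abs_lt]; constructor <;> linarith [Int.natCast_nonneg (x k).val]
  | succ T ih =>
    intro A z x hz hB
    have hP : 0 < b ^ T := pow_pos hb T
    have hz' : z < b * b ^ T := by rwa [← pow_succ']
    have hPle : b ^ T ≤ b ^ (T + 1) := Nat.pow_le_pow_right hb (Nat.le_succ T)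
    have hmod : z % b ^ T < b ^ T := Nat.mod_lt _ hP
    have hmodB : |((z % b ^ T : ℕ) : ℤ)| < 2 ^ B := by
      rw [Nat.abs_cast]; exact_mod_cast (by omega)
    have hzB : (z : ℤ) + 1 < 2 ^ B := by exact_mod_cast (by omega)
    have hbB : ((b * b ^ T : ℕ) : ℤ) + 1 < 2 ^ B := by
      rw [← pow_succ']; exact_mod_cast hB
    have hdB : (d : ℤ) + 2 < 2 ^ B := by exact_mod_cast hd
    have hbit : ∀ a : ZMod 2, (0 : ℤ) ≤ a.val ∧ (a.val : ℤ) ≤ 1 := fun a =>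
      ⟨Int.natCast_nonneg _, by exact_mod_cast val_zmod_two_le a⟩
    refine computes_hidden _ _ _ (ramp_sum x) ?_ <| computes_hidden _ _ _ (tag_sum hP hz' x) ?_ <|
      computes_hidden _ _ _ (mix_sum (A 0) x) ?_ <|
      computes_hidden _ _ _ (parity_sum (A 0) x) ?_ ?_
    · rintro ((_ | l) | p)
      · simp only [Sum.elim_inl, hashState, Nat.abs_cast]; linarith
      · have := hbit (x l)
        simp only [Sum.elim_inl, hashState, Nat.abs_cast]; linarith
      · have := bumpBias_mem (P := b ^ T) p.1 p.2
        rw [Sum.elim_inr, abs_lt]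
        constructor <;> linarith [Int.natCast_nonneg z]
    · rintro (_ | p)
      · exact hmodB
      · have := hbit (x p.2)
        rw [Option.elim_some, abs_lt]
        split_ifs <;> constructor <;> linarith
    · rintro (_ | q)
      · exact hmodB
      · have h1 : (rowDot (A 0) (tag b (z / b ^ T) x) q.1 : ℤ) ≤ d := by
          exact_mod_cast rowDot_tag_le _ _ _ _
        have h2 : ((q.2 : ℕ) : ℤ) ≤ d := by exact_mod_cast Nat.lt_succ_iff.1 q.2.2
        rw [Option.elim_some, abs_lt]
        constructor <;> linarith [Int.natCast_nonneg (q.2 : ℕ),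
          Int.natCast_nonneg (rowDot (A 0) (tag b (z / b ^ T) x) q.1)]
    · rintro (_ | k)
      · exact hmodB
      · have := hbit ((A 0 *ᵥ tag b (z / b ^ T) x) k)
        simp only [hashState, Nat.abs_cast]; linarith
    · simp only [max_eq_left (hashState_nonneg _ _ _)]
      exact ih (Fin.tail A) (z % b ^ T) _ hmod (by omega)

theorem digitNet_weights {B b d : ℕ} (hb : 0 < b) (hd : d + 2 < 2 ^ B) :
    ∀ (T : ℕ) (A : Fin T → MixMatrix b d), b ^ T + 1 < 2 ^ B →
      (digitNet T A).WeightsHaveBits B := by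
  have hdB : (d : ℤ) + 2 < 2 ^ B := by exact_mod_cast hd
  have hd0 := Int.natCast_nonneg d
  have h0 : |(0 : ℤ)| < 2 ^ B := by rw [abs_zero]; linarith
  have h1 : |(1 : ℤ)| < 2 ^ B := by rw [abs_one]; linarith
  intro T
  induction T with
  | zero =>
    intro A _
    refine intLayer_hasBits _ _ (fun j i => ?_) (fun j => h0)
    rcases i with _ | l
    · exact h0
    · simp only [readWeight]; split_ifs
      exacts [h1, h0]
  | succ T ih =>
    intro A hB
    have hPle : b ^ T ≤ b ^ (T + 1) := Nat.pow_le_pow_right hb (Nat.le_succ T)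
    have hbB : ((b * b ^ T : ℕ) : ℤ) + 1 < 2 ^ B := by
      rw [← pow_succ']; exact_mod_cast hB
    have hs : ∀ q, |bumpSign q| < 2 ^ B := fun q => by linarith [abs_bumpSign_le q]
    refine ⟨intLayer_hasBits _ _ ?_ ?_, intLayer_hasBits _ _ ?_ ?_, intLayer_hasBits _ _ ?_ ?_,
      intLayer_hasBits _ _ ?_ ?_, ih _ (by omega)⟩
    · rintro (o | p) i <;> simp only [rampWeight] <;> split_ifs
      exacts [h1, h0, h1, h0]
    · rintro (o | p)
      · exact h0
      · have := bumpBias_mem (P := b ^ T) p.1 p.2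
        rw [rampBias, abs_lt]
        constructor <;> linarith
    · rintro (_ | p) ((_ | l) | q) <;> simp only [tagWeight]
      · exact h1
      · exact h0
      · have h : (((q.1 : ℕ) : ℤ) + 1) * (b ^ T : ℕ) ≤ (b * b ^ T : ℕ) := by
          exact_mod_cast Nat.mul_le_mul_right (b ^ T) q.1.2
        have h' : (0 : ℤ) ≤ ((q.1 : ℕ) : ℤ) * (b ^ T : ℕ) := by positivity
        have h'' : (0 : ℤ) ≤ (b ^ T : ℕ) := by positivity
        rw [abs_mul, abs_neg, abs_of_nonneg h']
        nlinarith [abs_bumpSign_le q.2]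
      · exact h0
      · split_ifs
        exacts [h1, h0]
      · split_ifs
        exacts [hs _, h0]
    · rintro (_ | p)
      · exact h0
      · simpa [tagBias] using h1
    · rintro (_ | q) (_ | p) <;> simp only [mixWeight]
      · exact h1
      · exact h0
      · exact h0
      · have : ((A 0 q.1 p).val : ℤ) ≤ 1 := by exact_mod_cast val_zmod_two_le _
        rw [Nat.abs_cast]; linarith
    · rintro (_ | q)
      · exact h0
      · have h2 : ((q.2 : ℕ) : ℤ) ≤ d := by exact_mod_cast Nat.lt_succ_iff.1 q.2.2
        rw [mixBias, abs_neg, Nat.abs_cast]; linarith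
    · rintro (_ | k) (_ | q) <;> simp only [parityWeight]
      · exact h1
      · exact h0
      · exact h0
      · split_ifs
        · rw [sawCoeff]
          split_ifs
          · exact h1
          · rw [abs_mul, abs_pow, abs_neg, abs_one, one_pow, mul_one, abs_two]; linarith
        · exact h0
    · exact fun _ => h0

theorem hashNet_weights {B b d M T : ℕ} (hb : 0 < b) (hd : d + 2 < 2 ^ B) (hB : b ^ T + 1 < 2 ^ B)
    (hM : M ≤ 2 ^ B) (ω : HashSeed b d M T) : (hashNet ω).WeightsHaveBits B := by
  have hdB : (d : ℤ) + 2 < 2 ^ B := by exact_mod_cast hd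
  have h0 : |(0 : ℤ)| < 2 ^ B := by rw [abs_zero]; positivity
  refine ⟨intLayer_hasBits _ _ ?_ ?_, digitNet_weights hb hd T _ hB⟩
  · rintro (_ | l) i
    · rw [startWeight, Nat.abs_cast]
      exact_mod_cast (ω.1 i).2.trans_le hM
    · exact h0
  · rintro (_ | l)
    · exact h0
    · rw [startBias, abs_one]; linarith [Int.natCast_nonneg d]

theorem hashNet_computes {B b d M T : ℕ} (hb : 0 < b) (hd : d + 2 < 2 ^ B)
    (hB : b ^ T + 1 < 2 ^ B) (ω : HashSeed b d M T) (s : Fin d → ℕ)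
    (hs : seedDot ω.1 s < b ^ T) :
    Computes B (hashNet ω) (fun i => (s i : ℝ)) (fun k => ((vecHash ω s k).val : ℝ)) := by
  have hdB : (d : ℤ) + 2 < 2 ^ B := by exact_mod_cast hd
  have hsum : ∀ j, ∑ i, startWeight ω.1 j i * (s i : ℤ) + startBias d j =
      hashState (seedDot ω.1 s) (1 : Fin d → ZMod 2) j := by
    rintro (_ | l)
    · simp [startWeight, startBias, hashState, seedDot]
    · simp [startWeight, startBias, hashState, ZMod.val_one]
  have := computes_hidden (B := B) (Equiv.refl (Fin d)) (enum _) (N := digitNet T ω.2)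
    (y := fun k => (((vecHash ω s k).val : ℤ) : ℝ)) _ hsum ?_ ?_
  · exact_mod_cast this
  · rintro (_ | l)
    · rw [hashState, Nat.abs_cast]; exact_mod_cast (by omega)
    · simp only [hashState, Pi.one_apply, ZMod.val_one, Nat.cast_one, abs_one]
      linarith [Int.natCast_nonneg d]
  · simp only [max_eq_left (hashState_nonneg _ _ _)]
    exact digitNet_computes hb hd T ω.2 _ 1 hs hB

/-! ### Counting seeds -/

section Counting

open scoped Classical in
/-- The fraction of the elements of a finite type that satisfy a predicate. -/
noncomputable def fraction {α : Type} [Fintype α] (p : α → Prop) : ℝ :=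
  (Finset.univ.filter p).card / Fintype.card α

theorem fraction_mono {α : Type} [Fintype α] {p q : α → Prop} (h : ∀ a, p a → q a) :
    fraction p ≤ fraction q := by
  classical
  unfold fraction
  gcongr with a
  exact h a

theorem fraction_eq_sum {α : Type} [Fintype α] (p : α → Prop) [DecidablePred p] :
    fraction p = ∑ a, (if p a then 1 else 0) / (Fintype.card α : ℝ) := by
  unfold fraction
  rw [← Finset.sum_div, Finset.card_filter]
  push_cast
  congr! 1

theorem fraction_le_one {α : Type} [Fintype α] (p : α → Prop) : fraction p ≤ 1 := by
  classical
  exact div_le_one_of_le₀ (by exact_mod_cast Finset.card_filter_le _ _) (Nat.cast_nonneg _)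

theorem fraction_prod {α β : Type} [Fintype α] [Fintype β] (p : α × β → Prop) :
    fraction p = ∑ a, fraction (fun b => p (a, b)) / (Fintype.card α : ℝ) := by
  classical
  simp only [fraction_eq_sum, Finset.sum_div, Fintype.sum_prod_type, Fintype.card_prod,
    Nat.cast_mul, div_div, mul_comm]

/-- Conditioning on the first of two independent choices: bad first choices are charged in full, and
each good one leaves conditional probability at most `δ`. -/
theorem fraction_prod_le {α β : Type} [Fintype α] [Fintype β] {p : α × β → Prop} {q : α → Prop}
    {ε δ : ℝ} (hq : fraction q ≤ ε) (hδ : 0 ≤ δ) (hp : ∀ a, ¬ q a → fraction (fun b => p (a, b)) ≤ δ) :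
    fraction p ≤ ε + δ := by
  classical
  rw [fraction_prod]
  calc ∑ a, fraction (fun b => p (a, b)) / (Fintype.card α : ℝ)
      ≤ ∑ a, ((if q a then 1 else 0) / (Fintype.card α : ℝ) + δ / Fintype.card α) := by
        refine Finset.sum_le_sum fun a _ => ?_
        rw [← add_div]
        gcongr
        split_ifs with h
        · linarith [fraction_le_one (fun b => p (a, b))]
        · rw [zero_add]; exact hp a h
    _ = fraction q + ∑ _a : α, δ / Fintype.card α := by
        rw [Finset.sum_add_distrib, fraction_eq_sum q]
    _ ≤ ε + δ := by
        refine add_le_add hq ?_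
        rw [Finset.sum_const, nsmul_eq_mul, Finset.card_univ]
        rcases (Nat.cast_nonneg (α := ℝ) (Fintype.card α)).eq_or_lt with h0 | h0
        · rw [← h0, zero_mul]; exact hδ
        · rw [mul_div_cancel₀ _ h0.ne']

theorem fraction_equiv {α β : Type} [Fintype α] [Fintype β] (e : α ≃ β) (p : β → Prop) :
    fraction p = fraction (fun a => p (e a)) := by
  classical
  rw [fraction_eq_sum, fraction_eq_sum, Fintype.card_congr e]
  exact (Equiv.sum_comp e _).symm

theorem fraction_exists_le {α ι : Type} [Fintype α] (s : Finset ι) (p : ι → α → Prop) :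
    fraction (fun a => ∃ i ∈ s, p i a) ≤ ∑ i ∈ s, fraction (p i) := by
  classical
  unfold fraction
  rw [← Finset.sum_div]
  gcongr
  norm_cast
  refine le_trans (Finset.card_le_card ?_) Finset.card_biUnion_le
  intro a
  simp

/-- If every pair of an element of `γ` and an element with property `p` can be encoded in one
element, then `p` has density at most `1 / |γ|`. -/
theorem fraction_le_inv {α γ : Type} [Fintype α] [Fintype γ] [Nonempty γ] {p : α → Prop}
    (f : γ → α → α)
    (hf : ∀ y y' a a', p a → p a' → f y a = f y' a' → y = y' ∧ a = a') :
    fraction p ≤ 1 / Fintype.card γ := by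
  classical
  have h : Fintype.card γ * (Finset.univ.filter p).card ≤ Fintype.card α := by
    rw [← Finset.card_univ, ← Finset.card_product, ← Finset.card_univ]
    refine Finset.card_le_card_of_injOn (fun q => f q.1 q.2) (fun _ _ => Finset.mem_univ _) ?_
    rintro ⟨y, a⟩ hq ⟨y', a'⟩ hq' hqq
    simp only [Finset.coe_product, Finset.coe_univ, Set.mem_prod, Finset.coe_filter,
      Finset.mem_univ, true_and, Set.mem_ofPred_eq, Set.mem_univ] at hq hq'
    obtain ⟨h1, h2⟩ := hf y y' a a' hq hq' hqq
    rw [h1, h2]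
  have h' : (Fintype.card γ : ℝ) * (Finset.univ.filter p).card ≤ Fintype.card α := by
    exact_mod_cast h
  have hγ : (0 : ℝ) < Fintype.card γ := by exact_mod_cast Fintype.card_pos
  unfold fraction
  rcases (Nat.cast_nonneg (α := ℝ) (Fintype.card α)).eq_or_lt with h0 | h0
  · rw [← h0, div_zero]; positivity
  · rw [div_le_div_iff₀ h0 hγ]; linarith

end Counting

/-! ### Collision probabilities of the hash -/

/-- If `v c = 1`, adding `y` to column `c` of a matrix that kills `v` gives one that sends `v` to
`y`. So `y` and the original matrix can be recovered, and `2 ^ d` disjoint translates of the event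
fit. -/
theorem mulVec_eq_zero_fraction {d : ℕ} {κ : Type} [Fintype κ] [DecidableEq κ] {v : κ → ZMod 2}
    (hv : v ≠ 0) : fraction (fun A : Matrix (Fin d) κ (ZMod 2) => A *ᵥ v = 0) ≤ 1 / 2 ^ d := by
  obtain ⟨c, hc⟩ := Function.ne_iff.1 hv
  have hc1 : v c = 1 := by
    have : ∀ x : ZMod 2, x ≠ 0 → x = 1 := by decide
    exact this _ hc
  have key := fraction_le_inv (γ := Fin d → ZMod 2)
    (p := fun A : Matrix (Fin d) κ (ZMod 2) => A *ᵥ v = 0)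
    (fun y A => A + vecMulVec y (Pi.single c 1)) ?_
  · simpa [ZMod.card] using key
  · intro y y' A A' hA hA' h
    have hy : ∀ y : Fin d → ZMod 2, vecMulVec y (Pi.single c 1) *ᵥ v = y := by
      intro y; ext k; simp [vecMulVec_mulVec, hc1]
    have : y = y' := by
      have := congrArg (fun N => N *ᵥ v) h
      simpa [add_mulVec, hA, hA', hy] using this
    exact ⟨this, by simpa [this] using h⟩

/-- At a coordinate `c` where the vectors differ, a collision determines `a c` from the other
coefficients. Overwriting `a c` by an arbitrary value therefore loses no information. -/
theorem seedDot_eq_fraction {d M : ℕ} (hM : 0 < M) {s s' : Fin d → ℕ} (h : s ≠ s') :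
    fraction (fun a : Fin d → Fin M => seedDot a s = seedDot a s') ≤ 1 / M := by
  obtain ⟨c, hc⟩ := Function.ne_iff.1 h
  have : Nonempty (Fin M) := ⟨⟨0, hM⟩⟩
  have key := fraction_le_inv (γ := Fin M)
    (p := fun a : Fin d → Fin M => seedDot a s = seedDot a s')
    (fun y a => Function.update a c y) ?_
  · simpa using key
  · intro y y' a a' ha ha' hu
    have hy : y = y' := by simpa using congrFun hu c
    refine ⟨hy, ?_⟩
    have hne : ∀ i, i ≠ c → a i = a' i := fun i hi => by simpa [hi] using congrFun hu i
    funext i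
    by_cases hi : i = c
    · subst hi
      have split : ∀ (a : Fin d → Fin M) (s : Fin d → ℕ), (seedDot a s : ℤ) =
          a i * s i + ∑ j ∈ Finset.univ.erase i, ((a j : ℕ) : ℤ) * s j := by
        intro a s
        rw [seedDot, ← Finset.add_sum_erase _ _ (Finset.mem_univ i)]
        push_cast; rfl
      have hrest : ∀ s : Fin d → ℕ, ∑ j ∈ Finset.univ.erase i, ((a j : ℕ) : ℤ) * s j =
          ∑ j ∈ Finset.univ.erase i, ((a' j : ℕ) : ℤ) * s j := fun s =>
        Finset.sum_congr rfl fun j hj => by rw [hne j (Finset.ne_of_mem_erase hj)]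
      have e1 : (seedDot a s : ℤ) = seedDot a s' := by exact_mod_cast ha
      have e2 : (seedDot a' s : ℤ) = seedDot a' s' := by exact_mod_cast ha'
      rw [split, split] at e1 e2
      rw [hrest, hrest] at e1
      have hne : (s i : ℤ) - s' i ≠ 0 := sub_ne_zero.2 (by exact_mod_cast hc)
      have : (((a i : ℕ) : ℤ) - (a' i : ℕ)) * ((s i : ℤ) - s' i) = 0 := by linear_combination e1 - e2
      have := (mul_eq_zero.1 this).resolve_right hne
      exact Fin.ext (by omega)
    · exact hne i hi

/-- A nonzero family of states is rarely mapped to a family with sum zero. -/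
theorem digitHash_sum_fraction {b d : ℕ} (hb : 0 < b) :
    ∀ (T : ℕ) (S : Finset ℕ) (x : ℕ → Fin d → ZMod 2), (∀ z ∈ S, z < b ^ T) →
      (∃ z ∈ S, x z ≠ 0) →
      fraction (fun A : Fin T → MixMatrix b d => ∑ z ∈ S, digitHash T A z (x z) = 0) ≤
        T * (1 / 2 ^ d) := by
  classical
  intro T
  induction T with
  | zero =>
    rintro S x hS ⟨z, hz, hx⟩
    have hz0 : ∀ z ∈ S, z = 0 := fun z hz => by simpa using hS z hz
    have hS0 : S = {0} := Finset.eq_singleton_iff_unique_mem.2 ⟨hz0 z hz ▸ hz, hz0⟩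
    have : ¬ x 0 = 0 := hz0 z hz ▸ hx
    simp [hS0, digitHash, this, fraction]
  | succ T ih =>
    rintro S x hS ⟨z, hz, hx⟩
    have hP : 0 < b ^ T := pow_pos hb T
    let P := b ^ T
    -- Numbers with the same remainder meet the same later matrices, so by linearity their tagged
    -- states can be added before `A 0` is applied.
    let w : ℕ → Fin b × Fin d → ZMod 2 := fun r => ∑ z ∈ S with z % P = r, tag b (z / P) (x z)
    -- Within one residue class, distinct numbers have distinct leading digits, so their tags lie in
    -- disjoint blocks and cannot cancel.
    have hw : w (z % P) ≠ 0 := by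
      obtain ⟨l, hl⟩ := Function.ne_iff.1 hx
      have hzb : z / P < b := Nat.div_lt_of_lt_mul (by
        have := hS z hz
        rwa [pow_succ] at this)
      intro h0
      have := congrFun h0 (⟨z / P, hzb⟩, l)
      simp only [w, Finset.sum_apply] at this
      rw [Finset.sum_eq_single z] at this
      · exact hl (by simpa [tag] using this)
      · intro y hy hyz
        have hmod := (Finset.mem_filter.1 hy).2
        have : z / P ≠ y / P := fun h => hyz (by
          rw [← Nat.div_add_mod y P, ← Nat.div_add_mod z P, h, hmod])
        simp [tag, this]
      · intro h
        exact absurd (Finset.mem_filter.2 ⟨hz, rfl⟩ : z ∈ S.filter (· % P = z % P)) h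
    have hsum : ∀ A : Fin (T + 1) → MixMatrix b d, ∑ z ∈ S, digitHash (T + 1) A z (x z) =
        ∑ r ∈ S.image (· % P), digitHash T (Fin.tail A) r (A 0 *ᵥ w r) := by
      intro A
      rw [← Finset.sum_fiberwise_of_maps_to (g := (· % P)) (t := S.image (· % P))
        (fun z hz => Finset.mem_image_of_mem _ hz)]
      refine Finset.sum_congr rfl fun r _ => ?_
      have : A 0 *ᵥ w r = ∑ z ∈ S with z % P = r, A 0 *ᵥ tag b (z / P) (x z) :=
        map_sum (A 0).mulVecLin _ _
      rw [this, map_sum]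
      refine Finset.sum_congr rfl fun z hz => ?_
      rw [← (Finset.mem_filter.1 hz).2]
      rfl
    rw [fraction_equiv (Fin.consEquiv fun _ => MixMatrix b d)]
    have := fraction_prod_le (q := fun A : MixMatrix b d => A *ᵥ w (z % P) = 0)
      (p := fun A : MixMatrix b d × (Fin T → MixMatrix b d) =>
        ∑ z ∈ S, digitHash (T + 1) (Fin.consEquiv (fun _ => MixMatrix b d) A) z (x z) = 0)
      (mulVec_eq_zero_fraction hw) (δ := T * (1 / 2 ^ d)) (by positivity) ?_
    · refine this.trans (le_of_eq ?_)
      push_cast; ring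
    · intro A0 hA0
      simp only [hsum]
      refine le_trans (fraction_mono fun A h => ?_) (ih (S.image (· % P)) (fun r => A0 *ᵥ w r) ?_
        ⟨z % P, Finset.mem_image_of_mem _ hz, hA0⟩)
      · exact h
      · intro r hr
        obtain ⟨y, _, rfl⟩ := Finset.mem_image.1 hr
        exact Nat.mod_lt _ hP

/-- The hashes of the elements of a nonempty set rarely add up to zero modulo two. -/
theorem vecHash_sum_fraction {b d M T : ℕ} (hb : 0 < b) (hM : 0 < M) (hd : 0 < d)
    {S : Finset (Fin d → ℕ)} (hS : S.Nonempty)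
    (hlt : ∀ a : Fin d → Fin M, ∀ s ∈ S, seedDot a s < b ^ T) :
    fraction (fun ω : HashSeed b d M T => ∑ s ∈ S, vecHash ω s = 0) ≤
      S.card / M + T * (1 / 2 ^ d) := by
  classical
  obtain ⟨s₀, hs₀⟩ := hS
  -- The linear form need not be injective on `S`: it suffices that it separates the single vector
  -- `s₀` from the others.
  refine fraction_prod_le
    (q := fun a : Fin d → Fin M => ∃ s ∈ S.erase s₀, seedDot a s = seedDot a s₀) ?_ (by positivity) ?_
  · calc _ ≤ ∑ s ∈ S.erase s₀, fraction (fun a : Fin d → Fin M => seedDot a s = seedDot a s₀) :=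
        fraction_exists_le _ _
      _ ≤ ∑ s ∈ S.erase s₀, 1 / (M : ℝ) :=
        Finset.sum_le_sum fun s hs => seedDot_eq_fraction hM (Finset.ne_of_mem_erase hs)
      _ = (S.erase s₀).card / (M : ℝ) := by
        rw [Finset.sum_const, nsmul_eq_mul, mul_one_div]
      _ ≤ _ := by
        gcongr
        exact Finset.erase_subset _ _
  · intro a ha
    -- Vectors with equal numbers have equal hashes, and their initial states may cancel modulo 2;
    -- at the number of `s₀` only one all-ones state is present.
    let x : ℕ → Fin d → ZMod 2 := fun z => ∑ s ∈ S with seedDot a s = z, 1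
    refine le_trans (fraction_mono fun A h => ?_)
      (digitHash_sum_fraction hb T (S.image (seedDot a)) x ?_
        ⟨seedDot a s₀, Finset.mem_image_of_mem _ hs₀, ?_⟩)
    · rw [← h, ← Finset.sum_fiberwise_of_maps_to (g := seedDot a) (t := S.image (seedDot a))
        (fun s hs => Finset.mem_image_of_mem _ hs)]
      refine Finset.sum_congr rfl fun z _ => ?_
      rw [map_sum]
      refine Finset.sum_congr rfl fun s hs => ?_
      rw [vecHash, (Finset.mem_filter.1 hs).2]
    · intro z hz
      obtain ⟨s, hs, rfl⟩ := Finset.mem_image.1 hz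
      exact hlt a s hs
    · have : S.filter (fun s => seedDot a s = seedDot a s₀) = {s₀} := by
        refine Finset.eq_singleton_iff_unique_mem.2 ⟨by simp [hs₀], fun s hs => ?_⟩
        by_contra hne
        exact ha ⟨s, Finset.mem_erase.2 ⟨hne, (Finset.mem_filter.1 hs).1⟩,
          (Finset.mem_filter.1 hs).2⟩
      have hx : x (seedDot a s₀) = 1 := by simp [x, this]
      rw [hx]
      exact Function.ne_iff.2 ⟨⟨0, hd⟩, one_ne_zero⟩

/-! ### Distinguishing multisets by a sum modulo two -/

/-- After division by their gcd the coefficients are not all even. `S` consists of the indices with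
odd quotient, and reducing the divided relation modulo 2 leaves the sum over `S`. -/
theorem exists_odd_subset {σ : Type} (I : Finset σ) (a : σ → ℤ) (ha : ∃ s ∈ I, a s ≠ 0) :
    ∃ S ⊆ I, S.Nonempty ∧
      ∀ g : σ → ℤ, ∑ s ∈ I, a s * g s = 0 → ∑ s ∈ S, (g s : ZMod 2) = 0 := by
  classical
  obtain ⟨s₀, hs₀, hne⟩ := ha
  obtain ⟨a', ha', hgcd⟩ := I.extract_gcd a ⟨s₀, hs₀⟩
  have hD : I.gcd a ≠ 0 := fun h => hne (Finset.gcd_eq_zero_iff.1 h s₀ hs₀)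
  refine ⟨I.filter fun s => (a' s : ZMod 2) ≠ 0, Finset.filter_subset _ _, ?_, ?_⟩
  · by_contra hempty
    rw [Finset.not_nonempty_iff_eq_empty, Finset.filter_eq_empty_iff] at hempty
    have h2 : (2 : ℤ) ∣ I.gcd a' := Finset.dvd_gcd fun s hs => by
      have := not_not.1 (hempty hs)
      exact_mod_cast (ZMod.intCast_zmod_eq_zero_iff_dvd (a' s) 2).1 this
    rw [hgcd] at h2
    norm_num at h2
  · intro g hg
    have h0 : ∑ s ∈ I, a' s * g s = 0 := by
      have : I.gcd a * ∑ s ∈ I, a' s * g s = 0 := by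
        rw [← hg, Finset.mul_sum]
        exact Finset.sum_congr rfl fun s hs => by rw [ha' s hs, mul_assoc]
      exact (mul_eq_zero.1 this).resolve_left hD
    have h1 : ∑ s ∈ I, (a' s : ZMod 2) * (g s : ZMod 2) = 0 := by
      exact_mod_cast congrArg (Int.cast (R := ZMod 2)) h0
    refine Eq.trans ?_ h1
    rw [Finset.sum_filter]
    refine Finset.sum_congr rfl fun s _ => ?_
    have : ∀ c y : ZMod 2, (if c ≠ 0 then y else 0) = c * y := by decide
    exact this _ _

theorem sum_map_eq_sum_count {σ : Type} [DecidableEq σ] (m : Multiset σ) {I : Finset σ}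
    (hI : m.toFinset ⊆ I) (g : σ → ℤ) : (m.map g).sum = ∑ s ∈ I, (m.count s : ℤ) * g s := by
  rw [Finset.sum_multiset_map_count]
  simp only [nsmul_eq_mul]
  refine Finset.sum_subset hI fun s _ hs => ?_
  rw [Multiset.count_eq_zero_of_notMem (fun h => hs (Multiset.mem_toFinset.2 h))]
  simp

/-- The relevant coefficients are the differences of multiplicities. The order of quantifiers
matters: `S` does not depend on `g`, so it is fixed before the hash is sampled, and one `S` serves
all coordinates. -/
theorem exists_subset_of_multiset_ne {σ : Type} [DecidableEq σ] {m m' : Multiset σ} (h : m ≠ m')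
    {I : Finset σ} (hm : m.toFinset ⊆ I) (hm' : m'.toFinset ⊆ I) :
    ∃ S ⊆ I, S.Nonempty ∧
      ∀ g : σ → ℤ, (m.map g).sum = (m'.map g).sum → ∑ s ∈ S, (g s : ZMod 2) = 0 := by
  obtain ⟨s, hs⟩ : ∃ s, m.count s ≠ m'.count s := by
    by_contra hcon
    push Not at hcon
    exact h (Multiset.ext.2 hcon)
  have hsI : s ∈ I := by
    by_contra hsI
    apply hs
    rw [Multiset.count_eq_zero_of_notMem (fun h => hsI (hm (Multiset.mem_toFinset.2 h))),
      Multiset.count_eq_zero_of_notMem (fun h => hsI (hm' (Multiset.mem_toFinset.2 h)))]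
  obtain ⟨S, hSI, hS, hS'⟩ := exists_odd_subset I (fun s => (m.count s : ℤ) - m'.count s)
    ⟨s, hsI, sub_ne_zero.2 (by exact_mod_cast hs)⟩
  refine ⟨S, hSI, hS, fun g hg => hS' g ?_⟩
  rw [sum_map_eq_sum_count m hm, sum_map_eq_sum_count m' hm'] at hg
  simp only [sub_mul, Finset.sum_sub_distrib, hg, sub_self]

/-! ### Binary labels -/

/-- A vector over `ZMod 2` as a real vector. -/
def bitVec {d : ℕ} (x : Fin d → ZMod 2) : Fin d → ℝ := fun i => ((x i).val : ℝ)

theorem bitVec_injective {d : ℕ} : Function.Injective (bitVec (d := d)) := by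
  intro x y h
  funext i
  have := congrFun h i
  exact ZMod.val_injective 2 (Nat.cast_injective (R := ℝ) this)

theorem isBinary_bitVec {d : ℕ} (x : Fin d → ZMod 2) : IsBinary (bitVec x) := by
  intro i
  have h : ∀ a : ZMod 2, a.val = 0 ∨ a.val = 1 := by decide
  rcases h (x i) with h | h <;> simp only [bitVec, h] <;> simp

theorem exists_bitVec {d : ℕ} {h : Fin d → ℝ} (hh : IsBinary h) : ∃ x, h = bitVec x := by
  classical
  refine ⟨fun i => if h i = 0 then 0 else 1, funext fun i => ?_⟩
  rcases hh i with h | h <;> simp [bitVec, h, ZMod.val_one]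

section Labels

variable {n d : ℕ} (G : SimpleGraph (Fin n)) (x : Fin n → Fin d → ZMod 2)

/-- The sum, over the closed neighborhood, of binary labels. -/
noncomputable def nbhdSum (v : Fin n) : Fin d → ℕ := fun i => ∑ w ∈ closedNbhd G v, (x w i).val

theorem nbhdSum_le (v : Fin n) (i : Fin d) : nbhdSum G x v i ≤ n := by
  calc nbhdSum G x v i ≤ ∑ w ∈ closedNbhd G v, 1 :=
        Finset.sum_le_sum fun w _ => val_zmod_two_le _
    _ ≤ n := by
        rw [Finset.sum_const, smul_eq_mul, mul_one]
        simpa using Finset.card_le_univ (closedNbhd G v)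

theorem nbhdLabels_sum (v : Fin n) :
    (nbhdLabels G (fun w => bitVec (x w)) v).sum = fun i => (nbhdSum G x v i : ℝ) := by
  funext i
  change (∑ w ∈ closedNbhd G v, bitVec (x w)) i = _
  simp [Finset.sum_apply, bitVec, nbhdSum, -ZMod.natCast_val]

end Labels

/-! ### Laws of labels -/

theorem bind_toOuterMeasure_le {α β : Type} (p : PMF α) (f : α → PMF β) (s : Set β) {q : ℝ≥0∞}
    (h : ∀ a ∈ p.support, (f a).toOuterMeasure s ≤ q) : (p.bind f).toOuterMeasure s ≤ q := by
  rw [PMF.toOuterMeasure_bind_apply]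
  calc ∑' a, p a * (f a).toOuterMeasure s ≤ ∑' a, p a * q := by
        refine ENNReal.tsum_le_tsum fun a => ?_
        by_cases ha : a ∈ p.support
        · exact mul_le_mul_right (h a ha) _
        · rw [(PMF.apply_eq_zero_iff p a).2 ha, zero_mul, zero_mul]
    _ = q := by rw [ENNReal.tsum_mul_right, p.tsum_coe, one_mul]

theorem one_sub_le_toOuterMeasure {α : Type} (p : PMF α) (s : Set α) {q : ℝ≥0∞}
    (h : p.toOuterMeasure sᶜ ≤ q) : 1 - q ≤ p.toOuterMeasure s := by
  rw [tsub_le_iff_right]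
  calc (1 : ℝ≥0∞) = p.toOuterMeasure (s ∪ sᶜ) := by
        rw [Set.union_compl_self]
        exact ((p.toOuterMeasure_apply_eq_one_iff _).2 (Set.subset_univ _)).symm
    _ ≤ p.toOuterMeasure s + p.toOuterMeasure sᶜ := MeasureTheory.measure_union_le _ _
    _ ≤ _ := by gcongr

theorem uniform_map_toOuterMeasure {α β : Type} [Fintype α] [Nonempty α] (f : α → β) (s : Set β) :
    ((PMF.uniformOfFintype α).map f).toOuterMeasure s =
      ENNReal.ofReal (fraction fun a => f a ∈ s) := by
  classical
  rw [PMF.toOuterMeasure_map_apply, PMF.toOuterMeasure_uniformOfFintype_apply, fraction,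
    ENNReal.ofReal_div_of_pos (by exact_mod_cast Fintype.card_pos), ENNReal.ofReal_natCast,
    ENNReal.ofReal_natCast]
  congr 2
  rw [Fintype.card_subtype]
  congr! 1

theorem iterationLaw_map_fst {V : Type} [Fintype V] {d : ℕ} {ws : List ℕ} (G : SimpleGraph V)
    (E : PMF (V → Fin d → ℝ)) (D : PMF (ReLUNet d ws d)) :
    (iterationLaw G E D).map Prod.fst = E := by
  simp only [iterationLaw, PMF.map_bind, PMF.map_comp, Function.comp_def]
  refine Eq.trans (congrArg E.bind (funext fun h => PMF.map_const D h)) E.bind_pure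

theorem mem_support_iterationLaw {V : Type} [Fintype V] {d : ℕ} {ws : List ℕ} (G : SimpleGraph V)
    (E : PMF (V → Fin d → ℝ)) (D : PMF (ReLUNet d ws d)) (s) :
    s ∈ (iterationLaw G E D).support ↔
      ∃ h ∈ E.support, ∃ φ ∈ D.support, s = (h, gnnStep G φ h) := by
  simp only [iterationLaw, PMF.mem_support_bind_iff, PMF.mem_support_map_iff, eq_comm]

/-! ### From hash families to iterations of the WL test -/

/-- The networks compute hash functions of vectors with entries at most `n`, such that the hashes
of the elements of a nonempty set of size at most `n` add up to zero modulo two with probability at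
most `ε`. -/
structure IsHashFamily (n d B : ℕ) (ε : ℝ) {ws : List ℕ} {Ω : Type} [Fintype Ω]
    (net : Ω → ReLUNet d ws d) (F : Ω → (Fin d → ℕ) → Fin d → ZMod 2) : Prop where
  computes : ∀ ω s, (∀ i, s i ≤ n) → Computes B (net ω) (fun i => (s i : ℝ)) (bitVec (F ω s))
  sum_fraction : ∀ S : Finset (Fin d → ℕ), S.Nonempty → (∀ s ∈ S, ∀ i, s i ≤ n) → S.card ≤ n →
    fraction (fun ω => ∑ s ∈ S, F ω s = 0) ≤ ε

namespace IsHashFamily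

variable {n d B : ℕ} {ε : ℝ} {ws : List ℕ} {Ω : Type} [Fintype Ω]
  {net : Ω → ReLUNet d ws d} {F : Ω → (Fin d → ℕ) → Fin d → ZMod 2}

theorem gnnStep_eq (H : IsHashFamily n d B ε net F) (G : SimpleGraph (Fin n))
    (x : Fin n → Fin d → ZMod 2) (ω : Ω) :
    gnnStep G (net ω) (fun w => bitVec (x w)) = fun v => bitVec (F ω (nbhdSum G x v)) := by
  funext v
  rw [gnnStep, nbhdLabels_sum]
  exact (H.computes ω _ (nbhdSum_le G x v)).2

/-- Different multisets of new labels rarely have the same sum. -/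
theorem sum_collision (H : IsHashFamily n d B ε net F) (hε : 0 ≤ ε) (G : SimpleGraph (Fin n))
    (x : Fin n → Fin d → ZMod 2) (v u : Fin n) :
    fraction (fun ω =>
      nbhdLabels G (gnnStep G (net ω) fun w => bitVec (x w)) v ≠
        nbhdLabels G (gnnStep G (net ω) fun w => bitVec (x w)) u ∧
      (nbhdLabels G (gnnStep G (net ω) fun w => bitVec (x w)) v).sum =
        (nbhdLabels G (gnnStep G (net ω) fun w => bitVec (x w)) u).sum) ≤ ε := by
  classical
  simp only [H.gnnStep_eq]
  let σ := nbhdSum G x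
  have hmap : ∀ ω v, nbhdLabels G (fun w => bitVec (F ω (nbhdSum G x w))) v =
      ((closedNbhd G v).val.map σ).map fun s => bitVec (F ω s) := by
    intro ω v
    rw [Multiset.map_map]; rfl
  -- If the multisets of old sums agree, so do the multisets of new labels for every seed, and the
  -- event is empty.
  by_cases h : (closedNbhd G v).val.map σ = (closedNbhd G u).val.map σ
  · refine le_trans (fraction_mono (q := fun _ => False) fun ω hω => ?_) (by simpa [fraction])
    exact hω.1 (by rw [hmap, hmap, h])
  · have hI : ∀ v, ((closedNbhd G v).val.map σ).toFinset ⊆ Finset.univ.image σ := by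
      intro v s hs
      obtain ⟨w, _, rfl⟩ := Multiset.mem_map.1 (Multiset.mem_toFinset.1 hs)
      exact Finset.mem_image_of_mem _ (Finset.mem_univ w)
    obtain ⟨S, hSI, hS, hS'⟩ := exists_subset_of_multiset_ne h (hI v) (hI u)
    refine le_trans (fraction_mono fun ω hω => ?_) (H.sum_fraction S hS ?_ ?_)
    · have hsum := hω.2
      rw [nbhdLabels_sum, nbhdLabels_sum] at hsum
      funext i
      have hi := congrFun hsum i
      have := hS' (fun s => ((F ω s i).val : ℤ)) (by
        rw [Multiset.map_map, Multiset.map_map]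
        have hi' : nbhdSum G (fun w => F ω (σ w)) v i = nbhdSum G (fun w => F ω (σ w)) u i := by
          exact_mod_cast hi
        have : ((nbhdSum G (fun w => F ω (σ w)) v i : ℕ) : ℤ)
          = (nbhdSum G (fun w => F ω (σ w)) u i : ℕ) := by rw [hi']
        simp only [nbhdSum, Nat.cast_sum] at this
        exact this)
      rw [Finset.sum_apply]
      simpa using this
    · intro s hs
      obtain ⟨w, _, rfl⟩ := Finset.mem_image.1 (hSI hs)
      exact nbhdSum_le G x w
    · refine (Finset.card_le_card hSI).trans (Finset.card_image_le.trans ?_)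
      simp

/-- Different sums rarely lead to the same new label. -/
theorem label_collision (H : IsHashFamily n d B ε net F) (hn : 2 ≤ n) (hε : 0 ≤ ε)
    (G : SimpleGraph (Fin n)) (x : Fin n → Fin d → ZMod 2) (v u : Fin n) :
    fraction (fun ω =>
      (nbhdLabels G (fun w => bitVec (x w)) v).sum ≠ (nbhdLabels G (fun w => bitVec (x w)) u).sum ∧
      gnnStep G (net ω) (fun w => bitVec (x w)) v =
        gnnStep G (net ω) (fun w => bitVec (x w)) u) ≤ ε := by
  classical
  simp only [H.gnnStep_eq, nbhdLabels_sum]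
  by_cases h : nbhdSum G x v = nbhdSum G x u
  · refine le_trans (fraction_mono (q := fun _ => False) fun ω hω => ?_) (by simpa [fraction])
    exact hω.1 (by rw [h])
  · refine le_trans (fraction_mono fun ω hω => ?_)
      (H.sum_fraction {nbhdSum G x v, nbhdSum G x u} (Finset.insert_nonempty _ _) ?_ ?_)
    -- Equal hashes of two different sums add up to zero modulo 2, so a collision is the case of a
    -- two-element set.
    · rw [Finset.sum_pair h, bitVec_injective hω.2]
      exact funext fun i => CharTwo.add_self_eq_zero _
    · intro s hs
      rcases Finset.mem_insert.1 hs with rfl | hs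
      · exact nbhdSum_le G x v
      · rw [Finset.mem_singleton.1 hs]; exact nbhdSum_le G x u
    · rwa [Finset.card_pair h]

theorem labelLaw_binary [Nonempty Ω] (H : IsHashFamily n d B ε net F) (G : SimpleGraph (Fin n))
    {h₀ : Fin d → ℝ} (h₀b : IsBinary h₀) :
    ∀ k, ∀ h ∈ (labelLaw G h₀ ((PMF.uniformOfFintype Ω).map net) k).support,
      ∃ x : Fin n → Fin d → ZMod 2, h = fun w => bitVec (x w) := by
  intro k
  induction k with
  | zero =>
    intro h hh
    obtain ⟨x, rfl⟩ := exists_bitVec h₀b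
    rw [labelLaw, PMF.mem_support_pure_iff] at hh
    exact ⟨fun _ => x, hh⟩
  | succ k ih =>
    intro h hh
    rw [labelLaw, PMF.mem_support_map_iff] at hh
    obtain ⟨s, hs, rfl⟩ := hh
    obtain ⟨g, hg, φ, hφ, rfl⟩ := (mem_support_iterationLaw _ _ _ _).1 hs
    obtain ⟨x, rfl⟩ := ih g hg
    obtain ⟨ω, _, rfl⟩ := (PMF.mem_support_map_iff _ _ _).1 hφ
    exact ⟨_, H.gnnStep_eq G x ω⟩

/-- After any number of iterations, different multisets of labels rarely have the same sum. -/
theorem labelLaw_sum_collision [Nonempty Ω] (H : IsHashFamily n d B ε net F) (hε : 0 ≤ ε)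
    (G : SimpleGraph (Fin n)) {h₀ : Fin d → ℝ} (h₀b : IsBinary h₀) (h₀0 : h₀ ≠ 0) (k : ℕ)
    (v u : Fin n) :
    (labelLaw G h₀ ((PMF.uniformOfFintype Ω).map net) k).toOuterMeasure
      {h | nbhdLabels G h v ≠ nbhdLabels G h u ∧
        (nbhdLabels G h v).sum = (nbhdLabels G h u).sum} ≤ ENNReal.ofReal ε := by
  cases k with
  | zero =>
    -- No hash has acted yet: all labels equal `h₀ ≠ 0`, so the sum reveals the size of the
    -- neighborhood and thus the multiset.
    have hmap : ∀ v, nbhdLabels G (fun _ => h₀) v = Multiset.replicate (closedNbhd G v).card h₀ :=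
      fun v => Multiset.map_const' _ _
    rw [labelLaw, PMF.toOuterMeasure_pure_apply, if_neg]
    · exact bot_le
    · rintro ⟨hne, heq⟩
      obtain ⟨i, hi⟩ := Function.ne_iff.1 h₀0
      rw [hmap, hmap, Multiset.sum_replicate, Multiset.sum_replicate] at heq
      have := congrFun heq i
      simp only [Pi.smul_apply, nsmul_eq_mul] at this
      have hc : (closedNbhd G v).card = (closedNbhd G u).card := by
        exact_mod_cast mul_right_cancel₀ hi this
      exact hne (by rw [hmap, hmap, hc])
  | succ k =>
    rw [labelLaw, PMF.toOuterMeasure_map_apply]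
    -- The bound holds conditionally on every possible state before the last network, which is why
    -- it does not grow with `k`.
    refine bind_toOuterMeasure_le _ _ _ fun h hh => ?_
    obtain ⟨x, rfl⟩ := H.labelLaw_binary G h₀b k h hh
    rw [PMF.map_comp, uniform_map_toOuterMeasure]
    exact ENNReal.ofReal_le_ofReal (H.sum_collision hε G x v u)

/-- Different multisets with equal new labels either already had equal sums, an event about the
existing labels, or had different sums that the current network merges. Each case costs `ε`. -/
theorem isSuccessfulIteration [Nonempty Ω] (H : IsHashFamily n d B ε net F) (hn : 2 ≤ n)
    (hε : 0 ≤ ε) (G : SimpleGraph (Fin n)) {h₀ : Fin d → ℝ} (h₀b : IsBinary h₀) (h₀0 : h₀ ≠ 0)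
    (k : ℕ) :
    IsSuccessfulIteration G (labelLaw G h₀ ((PMF.uniformOfFintype Ω).map net) k)
      ((PMF.uniformOfFintype Ω).map net) (ENNReal.ofReal ε + ENNReal.ofReal ε) := by
  intro v u
  constructor
  · rw [PMF.toOuterMeasure_apply_eq_one_iff]
    intro s hs heq
    obtain ⟨h, _, φ, _, rfl⟩ := (mem_support_iterationLaw _ _ _ _).1 hs
    simp only [gnnStep]
    rw [heq]
  · apply one_sub_le_toOuterMeasure
    set D := (PMF.uniformOfFintype Ω).map net
    set E := labelLaw G h₀ D k
    have hsub : {s : (Fin n → Fin d → ℝ) × (Fin n → Fin d → ℝ) |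
        nbhdLabels G s.1 v ≠ nbhdLabels G s.1 u → s.2 v ≠ s.2 u}ᶜ ⊆
        (Prod.fst ⁻¹' {h | nbhdLabels G h v ≠ nbhdLabels G h u ∧
          (nbhdLabels G h v).sum = (nbhdLabels G h u).sum}) ∪
        {s | (nbhdLabels G s.1 v).sum ≠ (nbhdLabels G s.1 u).sum ∧ s.2 v = s.2 u} := by
      intro s hs
      have hs' : ¬ (nbhdLabels G s.1 v ≠ nbhdLabels G s.1 u → s.2 v ≠ s.2 u) := hs
      rw [Classical.not_imp, not_not] at hs'
      by_cases h : (nbhdLabels G s.1 v).sum = (nbhdLabels G s.1 u).sum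
      · exact Or.inl ⟨hs'.1, h⟩
      · exact Or.inr ⟨h, hs'.2⟩
    refine (MeasureTheory.measure_mono hsub).trans
      ((MeasureTheory.measure_union_le _ _).trans (add_le_add ?_ ?_))
    · rw [← PMF.toOuterMeasure_map_apply, iterationLaw_map_fst]
      exact H.labelLaw_sum_collision hε G h₀b h₀0 k v u
    · refine bind_toOuterMeasure_le _ _ _ fun h hh => ?_
      obtain ⟨x, rfl⟩ := H.labelLaw_binary G h₀b k h hh
      rw [PMF.map_comp, uniform_map_toOuterMeasure]
      exact ENNReal.ofReal_le_ofReal (H.label_collision hn hε G x v u)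

theorem performsWL [Nonempty Ω] (H : IsHashFamily n d B ε net F) (hn : 2 ≤ n) (hd : 0 < d)
    (hε : 0 ≤ ε) (hw : ∀ ω, (net ω).WeightsHaveBits B) {p : ℝ≥0∞}
    (hp : p = ENNReal.ofReal ε + ENNReal.ofReal ε) :
    PerformsWL n d B p ((PMF.uniformOfFintype Ω).map net) where
  dim_pos := hd
  weights φ hφ := by
    obtain ⟨ω, _, rfl⟩ := (PMF.mem_support_map_iff _ _ _).1 hφ
    exact hw ω
  successful G h₀ h₀b h₀0 k := hp ▸ H.isSuccessfulIteration hn hε G h₀b h₀0 k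
  binary G h₀ h₀b _ k h hh v := by
    obtain ⟨x, rfl⟩ := H.labelLaw_binary G h₀b k h hh
    exact isBinary_bitVec _
  values G h₀ h₀b _ k h hh φ hφ v := by
    obtain ⟨x, rfl⟩ := H.labelLaw_binary G h₀b k h hh
    obtain ⟨ω, _, rfl⟩ := (PMF.mem_support_map_iff _ _ _).1 hφ
    rw [nbhdLabels_sum]
    exact (H.computes ω _ (nbhdSum_le G x v)).1

end IsHashFamily

/-! ### Choice of the parameters -/

theorem hashNet_isHashFamily {n b d M T B : ℕ} {ε : ℝ} (hb : 0 < b) (hM : 0 < M) (hd : 0 < d)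
    (hdB : d + 2 < 2 ^ B) (hB : b ^ T + 1 < 2 ^ B) (hlt : d * (M * n) < b ^ T)
    (hε : (n : ℝ) / M + T * (1 / 2 ^ d) ≤ ε) :
    IsHashFamily n d B ε (hashNet (b := b) (d := d) (M := M) (T := T)) vecHash := by
  have hdot : ∀ (a : Fin d → Fin M) (s : Fin d → ℕ), (∀ i, s i ≤ n) → seedDot a s < b ^ T := by
    intro a s hs
    refine lt_of_le_of_lt ?_ hlt
    calc seedDot a s ≤ ∑ _i : Fin d, M * n :=
          Finset.sum_le_sum fun i _ => Nat.mul_le_mul (a i).2.le (hs i)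
      _ = d * (M * n) := by simp
  constructor
  · intro ω s hs
    exact hashNet_computes hb hdB hB ω s (hdot ω.1 s hs)
  · intro S hS hSn hcard
    refine (vecHash_sum_fraction hb hM hd hS fun a s hs => hdot a s (hSn s hs)).trans
      (le_trans ?_ hε)
    gcongr

theorem linear_le_two_pow (c : ℕ) : 3 * c + 14 ≤ 2 ^ (c + 4) := by
  have := Nat.lt_two_pow_self (n := c)
  rw [pow_add]; omega

theorem mul_lt_two_pow {c l k : ℕ} (hl : 1 ≤ l) (hk : k ≤ 3 * c + 14) :
    k * l ≤ 2 ^ ((c + 5) * l) := by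
  calc k * l ≤ 2 ^ (c + 4) * 2 ^ l :=
        Nat.mul_le_mul (hk.trans (linear_le_two_pow c)) Nat.lt_two_pow_self.le
    _ = 2 ^ (c + 4 + l) := (pow_add _ _ _).symm
    _ ≤ 2 ^ ((c + 5) * l) := Nat.pow_le_pow_right two_pos (by nlinarith)

/-- The constant in the size bounds. -/
def sizeConst (c : ℕ) : ℕ :=
  (12 * c + 58) + ((2 * c + 9) + 1 +
    (3 * c + 14) * (4 + (2 * c + 9) + (2 * c + 9) * (2 * c + 9 + 1) + 2 * (2 * c + 9) + 4))

/-- The label dimension is of order `l`, so the four layers of one digit have `O(b l ^ 2)` units;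
there are `O(l)` digits. -/
theorem hashWidths_sum_le {c l t b : ℕ} (hb : 1 ≤ b) (hl : 1 ≤ l) (htl : t ≤ l) :
    (hashWidths b ((2 * c + 9) * l) ((3 * c + 14) * t)).sum ≤ sizeConst c * (b * l ^ 3) := by
  rw [hashWidths, List.sum_cons, digitWidths_sum, Fintype.card_option, Fintype.card_fin, sizeConst]
  generalize 2 * c + 9 = D
  generalize 3 * c + 14 = R
  have h1 : 1 ≤ b * l ^ 2 := Nat.mul_pos hb (by positivity)
  have h2 : l ≤ b * l ^ 2 := by nlinarith
  have h3 : b ≤ b * l ^ 2 := Nat.le_mul_of_pos_right _ (by positivity)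
  have h4 : b * l ≤ b * l ^ 2 := by gcongr; nlinarith
  have h5 : l * l ≤ b * l ^ 2 := by nlinarith
  have h6 : b * l ^ 2 ≤ b * l ^ 3 := by gcongr; omega
  have key : 4 * b + b * (D * l) + D * l * (D * l + 1) + 2 * (D * l) + 4 ≤
      (4 + D + D * (D + 1) + 2 * D + 4) * (b * l ^ 2) := by
    calc _ = 4 * b + D * (b * l) + D * (D * (l * l) + l) + 2 * D * l + 4 * 1 := by ring
      _ ≤ 4 * (b * l ^ 2) + D * (b * l ^ 2) + D * (D * (b * l ^ 2) + b * l ^ 2)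
          + 2 * D * (b * l ^ 2) + 4 * (b * l ^ 2) := by gcongr
      _ = _ := by ring
  calc _ ≤ D * (b * l ^ 3) + b * l ^ 3 +
        R * l * ((4 + D + D * (D + 1) + 2 * D + 4) * (b * l ^ 2)) := by
        gcongr
        · exact h2.trans h6
        · exact h1.trans h6
    _ = (D + 1 + R * (4 + D + D * (D + 1) + 2 * D + 4)) * (b * l ^ 3) := by ring
    _ ≤ _ := Nat.mul_le_mul_right _ (Nat.le_add_left _ _)

theorem exists_performsWL (c : ℕ) {n l t g : ℕ} (hn : 2 ≤ n) (hnl : n ≤ 2 ^ l) (hl : 1 ≤ l)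
    (htl : t ≤ l) (hlg : l ≤ g * t) (hgl : g * t ≤ 2 * l) :
    ∃ (d B : ℕ) (ws : List ℕ) (D : PMF (ReLUNet d ws d)),
      PerformsWL n d B ((n : ℝ≥0∞) ^ c)⁻¹ D ∧ d ≤ sizeConst c * l ∧ B ≤ sizeConst c * l ∧
        ws.length + 1 ≤ sizeConst c * t ∧ ws.sum ≤ sizeConst c * (2 ^ g * l ^ 3) := by
  -- `M` makes the error of the linear form at most `1 / (4 n ^ c)`, and `d` does the same for the
  -- `T` matrices. `R` is chosen so that `R * l` bits, hence `T` digits of `g` bits, hold every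
  -- value of the linear form. `B` covers all these numbers.
  set R := 3 * c + 14 with hR
  set d := (2 * c + 9) * l with hd
  set T := R * t with hT
  set M := 2 ^ ((c + 1) * l + 2) with hM
  set B := g * T + d + 2 with hB
  have ht : 1 ≤ t := by
    rcases Nat.eq_zero_or_pos t with rfl | h
    · omega
    · exact h
  have hK : 12 * c + 58 ≤ sizeConst c := Nat.le_add_right _ _
  have hgT : R * l ≤ g * T := by
    calc R * l ≤ R * (g * t) := by gcongr
      _ = g * T := by rw [hT]; ring
  have hgT' : g * T ≤ 2 * (R * l) := by
    calc g * T = R * (g * t) := by rw [hT]; ring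
      _ ≤ R * (2 * l) := by gcongr
      _ = _ := by ring
  have hTl : T ≤ 2 ^ ((c + 5) * l) := (Nat.mul_le_mul_left R htl).trans (mul_lt_two_pow hl le_rfl)
  have hdl : d ≤ 2 ^ ((c + 5) * l) := mul_lt_two_pow hl (by omega)
  have hdpos : 0 < d := by positivity
  have hncl : n ^ c ≤ 2 ^ (c * l) := by
    rw [mul_comm, pow_mul]; gcongr
  have hMn : 4 * n ^ c * n ≤ M := by
    calc 4 * n ^ c * n ≤ 2 ^ 2 * 2 ^ (c * l) * 2 ^ l := by gcongr; norm_num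
      _ = M := by rw [← pow_add, ← pow_add, hM]; congr 1; ring
  have hdT : 4 * n ^ c * T ≤ 2 ^ d := by
    calc 4 * n ^ c * T ≤ 2 ^ 2 * 2 ^ (c * l) * 2 ^ ((c + 5) * l) := by gcongr; norm_num
      _ = 2 ^ (2 + c * l + (c + 5) * l) := by rw [← pow_add, ← pow_add]
      _ ≤ 2 ^ d := Nat.pow_le_pow_right two_pos (by rw [hd]; nlinarith)
  have hb : 0 < 2 ^ g := by positivity
  have hbT : (2 ^ g) ^ T = 2 ^ (g * T) := (pow_mul _ _ _).symm
  have hlt : d * (M * n) < (2 ^ g) ^ T := by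
    calc d * (M * n) ≤ 2 ^ ((c + 5) * l) * (2 ^ ((c + 1) * l + 2) * 2 ^ l) := by gcongr
      _ = 2 ^ ((c + 5) * l + ((c + 1) * l + 2 + l)) := by rw [← pow_add, ← pow_add]
      _ < 2 ^ (g * T) := by
        refine Nat.pow_lt_pow_right one_lt_two (lt_of_lt_of_le ?_ hgT)
        rw [hR]; nlinarith
      _ = _ := hbT.symm
  have hdB : d + 2 < 2 ^ B :=
    Nat.lt_two_pow_self.trans_le (Nat.pow_le_pow_right two_pos (by omega))
  have hTB : (2 ^ g) ^ T + 1 < 2 ^ B := by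
    have h1 : 1 ≤ 2 ^ (g * T) := Nat.one_le_two_pow
    calc (2 ^ g) ^ T + 1 < 2 ^ (g * T) * 2 ^ 2 := by rw [hbT]; omega
      _ = 2 ^ (g * T + 2) := (pow_add _ _ _).symm
      _ ≤ 2 ^ B := Nat.pow_le_pow_right two_pos (by omega)
  have hMB : M ≤ 2 ^ B := Nat.pow_le_pow_right two_pos (by
    have : (c + 1) * l ≤ R * l := by gcongr; omega
    omega)
  have hn0 : (0 : ℝ) < n := by exact_mod_cast (by omega : 0 < n)
  have hnc : (0 : ℝ) < (n : ℝ) ^ c := pow_pos hn0 c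
  have hM0 : 0 < M := by positivity
  -- Half of `n ^ (-c)`, because an iteration is charged for two hash failures.
  have hε : (n : ℝ) / M + T * (1 / 2 ^ d) ≤ 1 / (2 * (n : ℝ) ^ c) := by
    have e1 : (n : ℝ) / M ≤ 1 / (4 * (n : ℝ) ^ c) := by
      rw [div_le_div_iff₀ (by exact_mod_cast hM0) (by positivity)]
      have : (4 * (n : ℝ) ^ c) * n ≤ M := by exact_mod_cast hMn
      linarith
    have e2 : (T : ℝ) * (1 / 2 ^ d) ≤ 1 / (4 * (n : ℝ) ^ c) := by
      rw [mul_one_div, div_le_div_iff₀ (by positivity) (by positivity)]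
      have : (4 * (n : ℝ) ^ c) * T ≤ 2 ^ d := by exact_mod_cast hdT
      linarith
    refine (add_le_add e1 e2).trans (le_of_eq ?_)
    field_simp
    norm_num
  have : Nonempty (Fin M) := ⟨⟨0, hM0⟩⟩
  refine ⟨d, B, hashWidths (2 ^ g) d T, _, (hashNet_isHashFamily hb hM0 hdpos hdB hTB hlt hε).performsWL
    hn hdpos (by positivity) (hashNet_weights hb hdB hTB hMB) ?_, ?_, ?_, ?_, ?_⟩
  · rw [← ENNReal.ofReal_add (by positivity) (by positivity)]
    have : 1 / (2 * (n : ℝ) ^ c) + 1 / (2 * (n : ℝ) ^ c) = ((n : ℝ) ^ c)⁻¹ := by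
      field_simp
      norm_num
    rw [this, ENNReal.ofReal_inv_of_pos hnc, ENNReal.ofReal_pow hn0.le, ENNReal.ofReal_natCast]
  · rw [hd]; gcongr; omega
  · calc B ≤ 2 * (R * l) + (2 * c + 9) * l + 2 * l := by omega
      _ = (8 * c + 39) * l := by rw [hR]; ring
      _ ≤ _ := by gcongr; omega
  · rw [hashWidths, List.length_cons, digitWidths_length]
    calc 4 * T + 1 + 1 ≤ 4 * T + 2 * t := by omega
      _ = (12 * c + 58) * t := by rw [hT, hR]; ring
      _ ≤ _ := by gcongr
  · exact hashWidths_sum_le hb hl htl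

theorem natLog_add_one_le {n : ℕ} (hn : 2 ≤ n) : ((Nat.log 2 n + 1 : ℕ) : ℝ) ≤ 4 * Real.log n := by
  have h2 : (1 : ℝ) / 2 < Real.log 2 := by linarith [Real.log_two_gt_d9]
  have h2n : Real.log 2 ≤ Real.log n :=
    Real.log_le_log two_pos (by exact_mod_cast hn)
  have h : (Nat.log 2 n : ℝ) * Real.log 2 ≤ Real.log n := by
    rw [← Real.log_pow]
    refine Real.log_le_log (by positivity) ?_
    exact_mod_cast Nat.pow_log_le_self 2 (by omega : n ≠ 0)
  have : (Nat.log 2 n : ℝ) * (1 / 2) ≤ (Nat.log 2 n : ℝ) * Real.log 2 := by gcongr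
  push_cast
  linarith

theorem theorem3p3 :
    ∃ e : ℕ, ∀ c : ℕ, ∃ C : ℝ, ∀ n : ℕ, 2 ≤ n →
      (∃ (d B : ℕ) (ws : List ℕ) (D : PMF (ReLUNet d ws d)),
        PerformsWL n d B ((n : ℝ≥0∞) ^ c)⁻¹ D ∧
        (d : ℝ) ≤ C * Real.log n ∧
        (B : ℝ) ≤ C * Real.log n ∧
        ((ws.length + 1 : ℕ) : ℝ) ≤ C * Real.log n ∧
        (ws.sum : ℝ) ≤ C * Real.log n ^ e) ∧
      (∀ t : ℕ, 0 < t →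
        ∃ (d B : ℕ) (ws : List ℕ) (D : PMF (ReLUNet d ws d)),
          PerformsWL n d B ((n : ℝ≥0∞) ^ c)⁻¹ D ∧
          (d : ℝ) ≤ C * Real.log n ∧
          (B : ℝ) ≤ C * Real.log n ∧
          ((ws.length + 1 : ℕ) : ℝ) ≤ C * t ∧
          (ws.sum : ℝ) ≤ C * (n : ℝ) ^ (C / t) * Real.log n ^ e) := by
  -- The exponent 3 is that of `l ^ 3`. The factor is `128 = 2 * 4 ^ 3`, from `l ≤ 4 log n` and a
  -- factor 2 lost in rounding `g` up.
  refine ⟨3, fun c => ⟨128 * sizeConst c, fun n hn => ?_⟩⟩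
  set K := sizeConst c
  have hK : (1 : ℝ) ≤ K := by
    exact_mod_cast (show 1 ≤ sizeConst c from Nat.le_add_right_of_le (by omega))
  set l := Nat.log 2 n + 1 with hl
  have hn1 : (1 : ℝ) ≤ n := by exact_mod_cast (by omega : 1 ≤ n)
  have hlog : 0 ≤ Real.log n := Real.log_nonneg hn1
  have hnl : n ≤ 2 ^ l := (Nat.lt_pow_succ_log_self one_lt_two n).le
  have hll : (l : ℝ) ≤ 4 * Real.log n := natLog_add_one_le hn
  have hlin : ∀ m : ℕ, m ≤ K * l → (m : ℝ) ≤ 128 * K * Real.log n := fun m hm => by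
    calc (m : ℝ) ≤ K * l := by exact_mod_cast hm
      _ ≤ K * (4 * Real.log n) := by gcongr
      _ ≤ 128 * K * Real.log n := by nlinarith [mul_nonneg (by linarith : (0 : ℝ) ≤ K) hlog]
  have hcube : ∀ (m g : ℕ) (y : ℝ), m ≤ K * (2 ^ g * l ^ 3) → (2 : ℝ) ^ g ≤ 2 * y →
      (m : ℝ) ≤ 128 * K * y * Real.log n ^ 3 := fun m g y hm hy => by
    have hy0 : 0 ≤ 2 * y := le_trans (by positivity) hy
    calc (m : ℝ) ≤ K * (2 ^ g * (l : ℝ) ^ 3) := by exact_mod_cast hm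
      _ ≤ K * (2 * y * (4 * Real.log n) ^ 3) := by gcongr
      _ = 128 * K * y * Real.log n ^ 3 := by ring
  constructor
  · obtain ⟨d, B, ws, D, hD, h1, h2, h3, h4⟩ :=
      exists_performsWL c (g := 1) hn hnl (Nat.le_add_left 1 _) le_rfl (by omega) (by omega)
    exact ⟨d, B, ws, D, hD, hlin d h1, hlin B h2, hlin _ h3, by
      simpa using hcube _ 1 1 h4 (by norm_num)⟩
  · intro t ht
    -- For `t > l` more digits would not help: base 2 is already reached at `t' = l`.
    set t' := min t l
    have ht' : 0 < t' := lt_min ht (Nat.succ_pos _)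
    have hdiv := Nat.div_mul_le_self (l - 1) t'
    obtain ⟨d, B, ws, D, hD, h1, h2, h3, h4⟩ :=
      -- This `g` is `l / t'` rounded up. As `l - 1 = Nat.log 2 n`, for `t ≤ l` it gives `2 ^ g ≤ 2
      -- * n ^ (1 / t)`.
      exists_performsWL c (g := (l - 1) / t' + 1) (t := t') hn hnl (Nat.le_add_left 1 _)
        (min_le_right _ _) (by
          have := Nat.div_add_mod' (l - 1) t'
          have := Nat.mod_lt (l - 1) ht'
          rw [add_mul]; omega)
        (by
          have : t' ≤ l := min_le_right _ _
          rw [add_mul]; omega)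
    refine ⟨d, B, ws, D, hD, hlin d h1, hlin B h2, ?_, hcube _ _ _ h4 ?_⟩
    · calc ((ws.length + 1 : ℕ) : ℝ) ≤ K * t := by
            exact_mod_cast h3.trans (Nat.mul_le_mul_left _ (min_le_left _ _))
        _ ≤ 128 * K * t := by nlinarith [mul_nonneg (by linarith : (0 : ℝ) ≤ K) (Nat.cast_nonneg (α := ℝ) t)]
    · rw [pow_succ']
      refine mul_le_mul_of_nonneg_left ?_ zero_le_two
      have ht0 : (0 : ℝ) < t := by exact_mod_cast ht
      rcases le_total t l with htl | htl
      · have hpow : ((2 : ℝ) ^ ((l - 1) / t')) ^ t ≤ n := by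
          rw [← pow_mul, show t' = t from min_eq_left htl]
          have : 2 ^ ((l - 1) / t * t) ≤ n :=
            (Nat.pow_le_pow_right two_pos (Nat.div_mul_le_self _ _)).trans
              (Nat.pow_log_le_self 2 (by omega))
          exact_mod_cast this
        calc (2 : ℝ) ^ ((l - 1) / t') = (((2 : ℝ) ^ ((l - 1) / t')) ^ t) ^ ((t : ℝ)⁻¹) :=
              (Real.pow_rpow_inv_natCast (by positivity) ht.ne').symm
          _ ≤ (n : ℝ) ^ ((t : ℝ)⁻¹) := by gcongr
          _ ≤ (n : ℝ) ^ (128 * K / t : ℝ) := by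
            refine Real.rpow_le_rpow_of_exponent_le hn1 ?_
            rw [inv_eq_one_div]
            gcongr
            linarith
      · rw [show t' = l from min_eq_right htl, Nat.div_eq_of_lt (by omega), pow_zero]
        exact Real.one_le_rpow hn1 (by positivity)
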